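/- **Setting.** Consider an ideal gas with gas constant $R>0$, ratio of specific heats $\gamma>1$, viscosity $\mu(T)\ge 0$ and heat conductivity $\kappa(T)\ge 0$. The conservative variables are $u=[\rho,\rho V_1,\rho V_2,\rho V_3,\rho E]^\top$, with momentum $m_i=\rho V_i$, total energy $Et=\rho E$, pressure $P=(\gamma-1)(\rho E-\tfrac12\rho\|V\|^2)$ and temperature $T$ given by $P=\rho RT$. A state is *admissible* if $\rho>0$ and $T>0$. Let $S=-\rho s$, $s=\frac{R}{\gamma-1}\log T-R\log\rho$, $w=S_U$ (entropy variables), $S_{UU}$ the Hessian, and for an admissible constant state $u_0$ with zero velocity let $w_0=S_U(u_0)$ and $$\bar S(u)=S(u)-S(u_0)-S_U(u_0)^\top(u-u_0).$$ **Operators and grid.** Let $D,\mathcal P,\mathcal Q=\mathcal PD$ be the diagonal-norm Legendre–Gauss–Lobatto spectral collocation summation-by-parts operators of degree $p$ on $N=p+1$ points, $\mathcal Q+\mathcal Q^\top=\mathrm{diag}(-1,0,\dots,0,1)$, extended to three dimensions by tensor products. On a static conforming hexahedral grid with $K\ge1$ elements and periodic boundary conditions (each face point is glued to a face point with equal face quadrature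 weight and opposite outward normal) let $J>0$ be the Jacobian and $\hat a^l_m$ discrete metric terms with $\sum_l D_{\xi^l}\hat a^l_m=0$. Write $\hat U=[J]U$. **Scheme.** For a grid function $U$ with admissible values, the flux-limiting scheme is, on element $k$, $$\frac{d\hat U}{dt}=\theta_f^k\Big(\frac{d\hat U}{dt}\Big)_p+(1-\theta_f^k)\Big(\frac{d\hat U}{dt}\Big)_1+\Big(\frac{d\hat U}{dt}\Big)_{AD},\qquad 0\le\theta_f^k\le1,$$ $$\Big(\frac{d\hat U}{dt}\Big)_p=\sum_{l=1}^3-\mathcal P_{\xi^l}^{-1}\Delta_{\xi^l}\hat{\bar f}_l+D_{\xi^l}\hat f^{(v)}_l+\mathcal P_{\xi^l}^{-1}\hat g_l,\qquad \Big(\frac{d\hat U}{dt}\Big)_1=\text{the same with }\hat{\bar f}{}^{(MR)}_l\text{ in place of }\hat{\bar f}_l,$$ $$\Big(\frac{d\hat U}{dt}\Big)_{AD}=\sum_{l=1}^3\mathcal P_{\xi^l}^{-1}\Delta_{\xi^l}\big[(1-\theta_f^k)\hat{\bar f}{}^{(AD_1)}_{\hat\sigma,l}+\hat{\bar f}{}^{(AD_1)}_l\big]+D_{\xi^l}\hat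 f^{(AD_p)}_l+\mathcal P_{\xi^l}^{-1}\big[\hat g^{(AD_1)}_l+\hat g^{(AD_p)}_l\big],$$ where $\Delta_{\xi^l}$ is the difference of the fluxes at the two flux points adjacent to a solution point. The terms are as follows. * At the interior flux point between the solution points $i$ and $i+1$ of a grid line in direction $\xi^l$, $\hat{\bar f}_l=\sum_{r\le i<j}2q_{rj}\,f_S(U_r,U_j)\cdot\frac{\hat a^l_r+\hat a^l_j}2$, where $f_S$ is a symmetric, consistent two-point flux with $(w_1-w_2)^\top f_S(U_1,U_2)=\vec\psi_1-\vec\psi_2$ for admissible states, $\psi_m=w^\top F_m+\rho sV_m$, and $F_m$ are the Euler fluxes. At the two ends of the line $\hat{\bar f}_l=\hat{\bar f}{}^{(MR)}_l=\sum_m\hat a^l_mF_m$ (own state). * For a vector $n$ let $f^{MR}_n(U_1,U_2)=n\cdot f_S(U_1,U_2)-\tfrac12\mathcal Y|\Lambda|\mathcal Y^\top(w_2-w_1)$, where the columns of $\mathcal Y$ are eigenvectors, with eigenvalues $\Lambda$, of the Jacobian of $\sum_mn_mF_m$ at an admissible symmetric consistent average of $U_1,U_2$, scaled by $\mathcal Y\mathcal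 Y^\top=S_{UU}^{-1}$. At the interior flux points $\hat{\bar f}{}^{(MR)}_l=f^{MR}_{\bar a}(U_i,U_{i+1})$ with $\bar a=\sum_{r\le i<j}2q_{rj}\frac{\hat a^l_r+\hat a^l_j}2$. * The Brenner flux in direction $x_m$ is $[0,\tau_{1m},\tau_{2m},\tau_{3m},\sum_i\tau_{im}V_i+\kappa\,\partial_mT]^\top+\sigma\,\partial_m\rho\,[1,V,E]^\top$ with $\tau_{ij}=\mu(\partial_jV_i+\partial_iV_j-\tfrac23\delta_{ij}\,\mathrm{div}V)$, the gradients being expressed through the gradient of the entropy variables by the chain rule. The fluxes $\hat f^{(v)}_l=\sum_m\hat a^l_mf^{(v)}_{x_m}$ ($\mu(T),\kappa(T)$, $\sigma=0$) and $\hat f^{(AD_p)}_l$ ($\mu=\mu^{AD}\ge0$, $\kappa=c_T\mu^{AD}$, $\sigma=c_\rho\mu^{AD}/\rho$; $c_T,c_\rho>0$) use $\Theta_{x_j}=\sum_l\hat a^l_jJ^{-1}(D_{\xi^l}w+\mathcal P_{\xi^l}^{-1}\hat g^\Theta_l)$, where $\hat g^\Theta_l$ is supported on faces and equals $\pm\frac12$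 (neighbour value minus own value of $w$), with $+$ on the face $\xi^l=1$ and $-$ on $\xi^l=-1$. * The first-order Brenner flux in direction $n$ between $U_1$ and $U_2$ is $\sum_mn_m$ times the Brenner flux with the two-point gradient $\Theta_{x_j}=n_j(w_2-w_1)/h$, $h>0$, with symmetric consistent averages of $\rho>0,V,T>0,E$, and with arbitrary coefficients $\mu,\kappa,\sigma\ge0$. It gives $\hat{\bar f}{}^{(AD_1)}_l$ at interior flux points ($n=\bar a$; zero at the ends of the line), $\hat{\bar f}{}^{(AD_1)}_{\hat\sigma,l}$ (same, $\mu=\kappa=0$, $\sigma=\hat\sigma\ge 0$), and, across an interface in the outward normal direction, $\hat g^{(AD_1)}_l$. * At a face point with outward normal $n$ (the metric vector $\pm\hat a^l$), $\hat g_l$ is $\sum_mn_mF_m-f_n^{MR}(U,U^{nbr})$, plus half the jump of the normal viscous flux, $\frac12\sum_m n_m(f^{(v),nbr}_{x_m}-f^{(v)}_{x_m})$, plus an interior penalty of first-order Brenner form; $\hat g^{(AD_p)}_l$ is the analogous half jump of $f^{(AD_p)}$ plus such a penalty. Interface coefficients are the same seen from both sides. The limiter and all coefficients ($\theta_f^k$,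 $\mu^{AD}$, $\hat\sigma$, and the coefficients $\mu,\kappa,\sigma,h$ of the first-order terms and of the interior penalties) may depend arbitrarily on time and on the solution. **Theorem.** Let $t^1<t^2<\dots<t^n$, $n\ge1$, $\tau^i=t^{i+1}-t^i$, and let $U$ be continuous on $[t^1,t^n]$, pointwise admissible, and satisfy the scheme for $t\in(t^1,t^n)$ other than the time levels $t^i$. In the contracted sums below, $\frac{d\hat U_k}{dt}$ denotes the right-hand side of the scheme, and $\mathcal D:=-\sum_kw_k^\top\mathcal P\frac{d\hat U_k}{dt}$ is the total entropy dissipation. Then: 1. For all $t\in[t^1,t^n]$: $\mathcal D\ge0$, $\sum_k\mathbf 1_1^\top\mathcal P\frac{d\hat U_k}{dt}=0$, and $\sum_k(w_k-w_0)^\top\mathcal P\frac{d\hat U_k}{dt}=-\mathcal D$. 2. The discrete relative entropy $\sum_k\mathbf 1_1^\top\widehat{\mathcal P}[J]_k\bar S(U_k)$ is non-increasing on $[t^1,t^n]$. Writing $\hat{\bar{\mathbf S}}^i_k=[J]_k\bar S(U_k(t^i))$, for $1\le i<n$ the dissipation is integrable over $[t^i,t^{i+1}]$ with mean $\bar{\mathcal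 D}^i\ge0$, and $\sum_k\mathbf 1_1^\top\widehat{\mathcal P}\hat{\bar{\mathbf S}}^{i+1}_k\le\sum_k\mathbf 1_1^\top\widehat{\mathcal P}\hat{\bar{\mathbf S}}^i_k-\tau^i\bar{\mathcal D}^i$. Consequently $$\sum_k\mathbf 1_1^\top\widehat{\mathcal P}\hat{\bar{\mathbf S}}^n_k\le\mathcal C^{n-1}:=\sum_k\mathbf 1_1^\top\widehat{\mathcal P}\hat{\bar{\mathbf S}}^1_k-\sum_{i=1}^{n-1}\tau^i\bar{\mathcal D}^i\le\sum_k\mathbf 1_1^\top\widehat{\mathcal P}\hat{\bar{\mathbf S}}^1_k .$$ 3. At every solution point $a$ of every element $k$ there is an admissible $\widetilde U$ on the segment from $u_0$ to $U^n=U(t^n)$ with $S(U^n)=S(u_0)+S_U(u_0)^\top(U^n-u_0)+\frac12(U^n-u_0)^\top S_{UU}(\widetilde U)(U^n-u_0)$. 4. For every choice of such states $\widetilde U$, let $\lambda$ be the minimum eigenvalue of all the matrices $S_{UU}(\widetilde U_k(\vec\xi_a))$. Then $\lambda>0$, $$2\lambda\sum_k(U_k^n-U_0)^\top\mathcal P[J]_k(U_k^n-U_0)\le4\,\mathcal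 C^{n-1},\qquad \sum_k(U_k^n)^\top\mathcal P[J]_kU_k^n\le4\frac{\mathcal C^{n-1}}{\lambda}+2\sum_kU_0^\top\mathcal P[J]_kU_0 ,$$ where $U_0$ equals $u_0$ at every solution point. 5. With $$b_1=\frac{\rho}{R},\quad b_{i+1}=\frac{P+\rho V_i^2}{R}\ (i=1,2,3),\quad b_5=\frac{1}{R\rho}\Big(\frac{\gamma P^2}{(\gamma-1)^2}+\frac{\gamma P\rho\|V\|^2}{\gamma-1}+\Big(\frac{\rho\|V\|^2}2\Big)^2\Big),$$ the numbers $b_j(\widetilde U)$ are positive and at every solution point the quadratic form $(U^n-u_0)^\top S_{UU}(\widetilde U)(U^n-u_0)$ is at least $\frac{(\rho^n-\rho_0)^2}{b_1(\widetilde U)}$, $\frac{(m_i^n)^2}{b_{i+1}(\widetilde U)}$ $(i=1,2,3)$ and $\frac{(Et^n-Et_0)^2}{b_5(\widetilde U)}$. With $b_j^{\max}$ the maximum of $b_j(\widetilde U)$ over all solution points of all elements, and $\hat\rho=[J]\rho$ etc., $$\sum_k(\rho^n_k)^\top\widehat{\mathcal P}\hat\rho^n_k\le4b_1^{\max}\mathcal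 C^{n-1}+2\sum_k\rho_0^\top\widehat{\mathcal P}\hat\rho_0,\qquad \sum_k((m_i)_k^n)^\top\widehat{\mathcal P}(\hat m_i)_k^n\le2b_{i+1}^{\max}\mathcal C^{n-1}\ (i=1,2,3),$$ $$\sum_k(Et^n_k)^\top\widehat{\mathcal P}\widehat{Et}{}^n_k\le4b_5^{\max}\mathcal C^{n-1}+2\sum_kEt_0^\top\widehat{\mathcal P}\widehat{Et}_0 .$$ -/

import Mathlib

open scoped Matrix

namespace FluxLim

noncomputable section

/-! ## The compressible Navier-Stokes equations for an ideal gas -/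

/-- The conservative variables `[ρ, ρ V₁, ρ V₂, ρ V₃, ρ E]`. -/
abbrev State := Fin 5 → ℝ

/-- Vectors in the three Cartesian directions. -/
abbrev Vec3 := Fin 3 → ℝ

/-- Position of the `i`-th momentum component in the state vector. -/
def momIdx (i : Fin 3) : Fin 5 := i.castSucc.succ

/-- A calorically perfect gas: gas constant, ratio of specific heats, and the dynamic viscosity
and thermal conductivity as functions of the temperature. -/
structure Gas where
  R : ℝ
  γ : ℝ
  visc : ℝ → ℝ
  cond : ℝ → ℝ
  R_pos : 0 < R
  one_lt_γ : 1 < γ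
  visc_nonneg : ∀ T, 0 < T → 0 ≤ visc T
  cond_nonneg : ∀ T, 0 < T → 0 ≤ cond T

def density (u : State) : ℝ := u 0

def momentum (u : State) (i : Fin 3) : ℝ := u (momIdx i)

def velocity (u : State) (i : Fin 3) : ℝ := momentum u i / density u

/-- The total energy per unit volume `ρ E`. -/
def totalEnergy (u : State) : ℝ := u 4

/-- The specific total energy `E`. -/
def specificEnergy (u : State) : ℝ := totalEnergy u / density u

/-- The internal energy per unit volume. -/
def internalEnergy (u : State) : ℝ :=
  totalEnergy u - (∑ i, momentum u i ^ 2) / (2 * density u)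

namespace Gas

def pressure (g : Gas) (u : State) : ℝ := (g.γ - 1) * internalEnergy u

/-- The temperature, from `P = ρ R T`. -/
def temperature (g : Gas) (u : State) : ℝ := g.pressure u / (density u * g.R)

/-- The admissible set: positive density and temperature. -/
def Admissible (g : Gas) (u : State) : Prop := 0 < density u ∧ 0 < g.temperature u

/-- The thermodynamic entropy `s = c_v log T - R log ρ`, `c_v = R / (γ - 1)`. -/
def specificEntropy (g : Gas) (u : State) : ℝ :=
  g.R / (g.γ - 1) * Real.log (g.temperature u) - g.R * Real.log (density u)

/-- The entropy function `S = -ρ s`. -/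
def entropy (g : Gas) (u : State) : ℝ := -(density u * g.specificEntropy u)

/-- The entropy variables `w = S_U`. -/
def entropyVar (g : Gas) (u : State) : State :=
  fun i => fderiv ℝ g.entropy u (Pi.single i 1)

/-- The Hessian `S_UU`. -/
def entropyHessian (g : Gas) (u : State) : Matrix (Fin 5) (Fin 5) ℝ :=
  Matrix.of fun i j => fderiv ℝ (fun v => g.entropyVar v j) u (Pi.single i 1)

/-- The relative entropy `S̄ = S - S(u₀) - S_U(u₀)ᵀ (u - u₀)`. -/
def relEntropy (g : Gas) (u₀ u : State) : ℝ :=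
  g.entropy u - g.entropy u₀ - g.entropyVar u₀ ⬝ᵥ (u - u₀)

/-- The inviscid flux in the `m`-th Cartesian direction; the last entry is `ρ V_m H` with the
specific total enthalpy `H = E + P / ρ`. -/
def eulerFlux (g : Gas) (u : State) (m : Fin 3) : State :=
  let V := velocity u
  let P := g.pressure u
  ![density u * V m,
    density u * V m * V 0 + (if m = 0 then P else 0),
    density u * V m * V 1 + (if m = 1 then P else 0),
    density u * V m * V 2 + (if m = 2 then P else 0),
    density u * V m * (specificEnergy u + P / density u)]

/-- The entropy flux `-ρ s V`. -/
def entropyFlux (g : Gas) (u : State) (m : Fin 3) : ℝ :=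
  -(density u * g.specificEntropy u * velocity u m)

/-- The potential flux `ψ_m = wᵀ F_m - 𝓕_m`. -/
def entropyPotential (g : Gas) (u : State) (m : Fin 3) : ℝ :=
  g.entropyVar u ⬝ᵥ g.eulerFlux u m - g.entropyFlux u m

/-- The inviscid flux in the direction of a (not normalized) vector `n`. -/
def directedFlux (g : Gas) (n : Vec3) (u : State) : State := ∑ m, n m • g.eulerFlux u m

/-- The Jacobian of the directed inviscid flux. -/
def fluxJacobian (g : Gas) (n : Vec3) (u : State) : Matrix (Fin 5) (Fin 5) ℝ :=
  Matrix.of fun i j => fderiv ℝ (fun v => g.directedFlux n v i) u (Pi.single j 1)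

/-- `M = 𝒴 |Λ| 𝒴ᵀ`, where the columns of `𝒴` are eigenvectors of the flux Jacobian with
eigenvalues `Λ`, scaled so that `𝒴 𝒴ᵀ = S_UU⁻¹ = ∂U/∂w`. -/
def IsMerriamRoe (g : Gas) (n : Vec3) (u : State) (M : Matrix (Fin 5) (Fin 5) ℝ) : Prop :=
  ∃ (Y : Matrix (Fin 5) (Fin 5) ℝ) (ev : Fin 5 → ℝ),
    g.fluxJacobian n u * Y = Y * Matrix.diagonal ev ∧
    g.entropyHessian u * (Y * Yᵀ) = 1 ∧
    M = Y * Matrix.diagonal (fun i => |ev i|) * Yᵀ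

open Classical in
/-- The Merriam-Roe dissipation matrix (at an admissible state there is exactly one). -/
def merriamRoe (g : Gas) (n : Vec3) (u : State) : Matrix (Fin 5) (Fin 5) ℝ :=
  if h : ∃ M, g.IsMerriamRoe n u M then h.choose else 0

end Gas

/-! ## Viscous and Brenner fluxes -/

/-- The viscous stress tensor `τ_{ij}`, where `gradV i j = ∂V_i/∂x_j`. -/
def stress (μ : ℝ) (gradV : Fin 3 → Fin 3 → ℝ) (i j : Fin 3) : ℝ :=
  μ * (gradV i j + gradV j i - if i = j then 2 / 3 * ∑ n, gradV n n else 0)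

/-- The Brenner flux in the `m`-th Cartesian direction: the Navier-Stokes viscous flux with
viscosity `μ` and conductivity `κ`, plus the mass diffusion `σ ∂ρ/∂x_m [1, V, E]`.
The Navier-Stokes viscous flux is the case `σ = 0`. -/
def brennerFlux (V : Vec3) (E μ κ σ : ℝ) (gradV : Fin 3 → Fin 3 → ℝ) (gradT gradρ : Vec3)
    (m : Fin 3) : State :=
  let τ := stress μ gradV
  ![σ * gradρ m,
    τ 0 m + σ * gradρ m * V 0,
    τ 1 m + σ * gradρ m * V 1,
    τ 2 m + σ * gradρ m * V 2,
    ∑ i, τ i m * V i + κ * gradT m + σ * gradρ m * E]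

/-- The Brenner flux as a function of the gradient `Θ` of the entropy variables (`Θ j` is the
derivative in the direction `x_j`), i.e. `∑_j c_{m,j} Θ_j`. The gradients of velocity,
temperature and density come from `w = [·, V / T, -1 / T]` and the chain rule:
`dV_i = T (dw_{i+1} + V_i dw_5)`, `dT = T² dw_5`, `R dρ / ρ = dw_1 + V · dw_{2..4} + E dw_5`. -/
def brennerFluxW (g : Gas) (ρ : ℝ) (V : Vec3) (T E μ κ σ : ℝ) (Θ : Fin 3 → State)
    (m : Fin 3) : State :=
  brennerFlux V E μ κ σ
    (fun i j => T * (Θ j (momIdx i) + V i * Θ j 4))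
    (fun j => T ^ 2 * Θ j 4)
    (fun j => ρ / g.R * (Θ j 0 + ∑ i, V i * Θ j (momIdx i) + E * Θ j 4))
    m

/-! ## Summation-by-parts operators and grids -/

/-- The diagonal-norm spectral collocation operator of polynomial degree `p` on `[-1, 1]`.
The nodes are increasing and contain the end points, `D` differentiates polynomials of degree
at most `p` exactly, and `𝒬 = 𝒫 D` satisfies `𝒬 + 𝒬ᵀ = diag(-1, 0, …, 0, 1)`; hence the
quadrature with weights `𝒫` is exact up to degree `2 p - 1` and the nodes are the
Legendre-Gauss-Lobatto nodes. -/
structure SBP (p : ℕ) where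
  x : Fin (p + 1) → ℝ
  P : Fin (p + 1) → ℝ
  D : Fin (p + 1) → Fin (p + 1) → ℝ
  x_strictMono : StrictMono x
  x_first : x 0 = -1
  x_last : x (Fin.last p) = 1
  P_pos : ∀ i, 0 < P i
  D_exact : ∀ f : Polynomial ℝ, f.natDegree ≤ p →
    ∀ i, ∑ j, D i j * f.eval (x j) = f.derivative.eval (x i)
  sbp : ∀ i j, P i * D i j + P j * D j i =
    (if i = Fin.last p ∧ j = Fin.last p then 1 else 0) - (if i = 0 ∧ j = 0 then 1 else 0)

/-- Entries of the stiffness matrix `𝒬 = 𝒫 D`. -/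
def SBP.Q {p : ℕ} (B : SBP p) (i j : Fin (p + 1)) : ℝ := B.P i * B.D i j

/-- Solution points of an element. -/
abbrev Node (p : ℕ) := Fin 3 → Fin (p + 1)

/-- Pairs of tangential indices. -/
abbrev Tang (p : ℕ) := Fin 2 → Fin (p + 1)

/-- The `i`-th point of the grid line in direction `l` with tangential indices `b`. -/
def lineNode {p : ℕ} (l : Fin 3) (b : Tang p) (i : Fin (p + 1)) : Node p :=
  Fin.insertNth (α := fun _ => Fin (p + 1)) l i b

/-- The tangential indices of a node with respect to the direction `l`. -/
def tang {p : ℕ} (l : Fin 3) (a : Node p) : Tang p :=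
  Fin.removeNth (α := fun _ => Fin (p + 1)) l a

/-- Face points: element, direction, side (`true` is the end `ξ = 1`), tangential indices. -/
abbrev FacePt (K p : ℕ) := Fin K × Fin 3 × Bool × Tang p

/-- Interior flux points: element, direction, tangential indices, and the index `r` of the flux
point between the solution points `r` and `r + 1`. -/
abbrev InnerPt (K p : ℕ) := Fin K × Fin 3 × Tang p × Fin p

/-- Discrete solutions. -/
abbrev Grid (K p : ℕ) := Fin K → Node p → State

def endIdx {p : ℕ} (side : Bool) : Fin (p + 1) := if side then Fin.last p else 0

def sideSign (side : Bool) : ℝ := if side then 1 else -1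

def FacePt.node {K p : ℕ} (f : FacePt K p) : Node p :=
  lineNode f.2.1 f.2.2.2 (endIdx f.2.2.1)

/-- Value of a grid function at the solution point collocated with a face point. -/
def FacePt.val {K p : ℕ} {α : Type} (f : FacePt K p) (φ : Fin K → Node p → α) : α :=
  φ f.1 (FacePt.node f)

namespace SBP

variable {p : ℕ} (B : SBP p)

/-- The tensor product weight `𝒫_{ijk}`. -/
def weight (a : Node p) : ℝ := ∏ l, B.P (a l)

/-- The tensor product weight on a face. -/
def faceWeight (b : Tang p) : ℝ := ∏ i, B.P (b i)

/-- `D_{ξ^l}` applied to a grid function on one element. -/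
def diff {V : Type} [AddCommGroup V] [Module ℝ V] (l : Fin 3) (φ : Node p → V) (a : Node p) : V :=
  ∑ j, B.D (a l) j • φ (lineNode l (tang l a) j)

/-- `𝒫_{ξ^l}^{-1} Δ_{ξ^l}` applied to fluxes given at the `p + 2` flux points of each line. -/
def fluxDiff (l : Fin 3) (F : Tang p → Fin (p + 2) → State) (a : Node p) : State :=
  (B.P (a l))⁻¹ • (F (tang l a) (a l).succ - F (tang l a) (a l).castSucc)

/-- `𝒫_{ξ^l}^{-1}` applied to a penalty supported on the two faces `ξ^l = ±1` of element `k`. -/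
def penalty {K : ℕ} (G : FacePt K p → State) (k : Fin K) (l : Fin 3) (a : Node p) : State :=
  (B.P (a l))⁻¹ • ∑ side : Bool, if a l = endIdx side then G (k, l, side, tang l a) else 0

end SBP

/-- A static conforming unstructured hexahedral grid with `K` elements and periodic boundary
conditions, so that every face point is glued to a face point. `J` is the Jacobian and
`metric k l a m` the discrete metric term `â^l_m ≈ J ∂ξ^l/∂x_m`, which satisfies the geometric
conservation law; glued face points have equal quadrature weights and opposite outward normals. -/
structure Mesh (K p : ℕ) (B : SBP p) where
  J : Fin K → Node p → ℝ
  J_pos : ∀ k a, 0 < J k a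
  metric : Fin K → Fin 3 → Node p → Vec3
  gcl : ∀ k a, ∑ l, B.diff l (metric k l) a = 0
  nbr : FacePt K p → FacePt K p
  nbr_nbr : ∀ f, nbr (nbr f) = f
  nbr_weight : ∀ f, B.faceWeight (nbr f).2.2.2 = B.faceWeight f.2.2.2
  nbr_normal : ∀ f : FacePt K p,
    sideSign (nbr f).2.2.1 • metric (nbr f).1 (nbr f).2.1 (FacePt.node (nbr f)) =
      -(sideSign f.2.2.1 • metric f.1 f.2.1 (FacePt.node f))

/-- The outward normal (scaled by the surface metric) at a face point. -/
def Mesh.normal {K p : ℕ} {B : SBP p} (M : Mesh K p B) (f : FacePt K p) : Vec3 :=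
  sideSign f.2.2.1 • M.metric f.1 f.2.1 (FacePt.node f)

/-! ## Two-point fluxes -/

/-- A symmetric, consistent, entropy conservative two-point flux. -/
structure ECFlux (g : Gas) where
  flux : State → State → Fin 3 → State
  symm : ∀ u v, g.Admissible u → g.Admissible v → ∀ m, flux u v m = flux v u m
  consistent : ∀ u, g.Admissible u → ∀ m, flux u u m = g.eulerFlux u m
  conservative : ∀ u v, g.Admissible u → g.Admissible v → ∀ m,
    (g.entropyVar u - g.entropyVar v) ⬝ᵥ flux u v m = g.entropyPotential u m - g.entropyPotential v m

/-- The two-point flux in the direction `n`. -/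
def ECFlux.directed {g : Gas} (F : ECFlux g) (n : Vec3) (u v : State) : State :=
  ∑ m, n m • F.flux u v m

/-- Symmetric, consistent averages of two states: the state at which the Merriam-Roe matrix is
evaluated, and the density, velocity, temperature and specific total energy at which the
first-order Brenner flux is evaluated. -/
structure Averages (g : Gas) where
  roe : State → State → State
  rho : State → State → ℝ
  vel : State → State → Vec3
  temp : State → State → ℝ
  energy : State → State → ℝ
  roe_adm : ∀ u v, g.Admissible u → g.Admissible v → g.Admissible (roe u v)
  rho_pos : ∀ u v, g.Admissible u → g.Admissible v → 0 < rho u v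
  temp_pos : ∀ u v, g.Admissible u → g.Admissible v → 0 < temp u v
  symm : ∀ u v, g.Admissible u → g.Admissible v →
    roe u v = roe v u ∧ rho u v = rho v u ∧ vel u v = vel v u ∧ temp u v = temp v u ∧
      energy u v = energy v u
  consistent : ∀ u, g.Admissible u →
    roe u u = u ∧ rho u u = density u ∧ vel u u = velocity u ∧ temp u u = g.temperature u ∧
      energy u u = specificEnergy u

/-- Coefficients of a first-order Brenner flux at a flux point: viscosity, conductivity, volume
diffusivity, and the (Jacobian weighted) distance `h` between the two solution points. -/
structure BrennerCoeff where
  μ : ℝ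
  κ : ℝ
  σ : ℝ
  h : ℝ
  μ_nonneg : 0 ≤ μ
  κ_nonneg : 0 ≤ κ
  σ_nonneg : 0 ≤ σ
  h_pos : 0 < h

/-- The first-order Brenner flux in the direction `n` between the states `u` and `v`: the Brenner
flux with averaged coefficients, contracted with `n`, for the two-point gradient
`n (w(v) - w(u)) / h` of the entropy variables. -/
def brennerTwoPoint {g : Gas} (A : Averages g) (c : BrennerCoeff) (n : Vec3) (u v : State) :
    State :=
  ∑ m, n m • brennerFluxW g (A.rho u v) (A.vel u v) (A.temp u v) (A.energy u v) c.μ c.κ c.σ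
    (fun j => (n j / c.h) • (g.entropyVar v - g.entropyVar u)) m

/-! ## The flux-limiting scheme -/

/-- The fixed data of the scheme. `cρ` and `cT` are the tunable coefficients of the artificial
dissipation. -/
structure Scheme (K p : ℕ) where
  gas : Gas
  sbp : SBP p
  mesh : Mesh K p sbp
  ec : ECFlux gas
  avg : Averages gas
  cρ : ℝ
  cT : ℝ
  cρ_pos : 0 < cρ
  cT_pos : 0 < cT

/-- The adaptive coefficients of the scheme at one instant: the flux limiter `θ_f^k`, the
high-order artificial viscosity, the coefficients of the first-order Brenner dissipation at the
interior flux points and at the interfaces, the additional interior volume diffusivity `σ̂`, and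
the coefficients of the interior penalties of the viscous and high-order Brenner terms at the
interfaces. -/
structure Coeffs {K p : ℕ} (X : Scheme K p) where
  θ : Fin K → ℝ
  μAD : Fin K → Node p → ℝ
  ad : InnerPt K p → BrennerCoeff
  adFace : FacePt K p → BrennerCoeff
  σhat : InnerPt K p → ℝ
  ipVisc : FacePt K p → BrennerCoeff
  ipAD : FacePt K p → BrennerCoeff
  θ_mem : ∀ k, θ k ∈ Set.Icc (0 : ℝ) 1
  μAD_nonneg : ∀ k a, 0 ≤ μAD k a
  σhat_nonneg : ∀ q, 0 ≤ σhat q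
  adFace_nbr : ∀ f, adFace (X.mesh.nbr f) = adFace f
  ipVisc_nbr : ∀ f, ipVisc (X.mesh.nbr f) = ipVisc f
  ipAD_nbr : ∀ f, ipAD (X.mesh.nbr f) = ipAD f

/-- The coefficients of the additional mass diffusion at an interior flux point. -/
def Coeffs.mass {K p : ℕ} {X : Scheme K p} (c : Coeffs X) (q : InnerPt K p) : BrennerCoeff where
  μ := 0
  κ := 0
  σ := c.σhat q
  h := (c.ad q).h
  μ_nonneg := le_rfl
  κ_nonneg := le_rfl
  σ_nonneg := c.σhat_nonneg q
  h_pos := (c.ad q).h_pos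

namespace Scheme

variable {K p : ℕ} (X : Scheme K p)

/-- The entropy variables at the solution points. -/
def w (U : Grid K p) : Grid K p := fun k a => X.gas.entropyVar (U k a)

/-- The metric terms at the interior flux points:
`∑_{i ≤ r < j} 2 q_{ij} (â(ξ_i) + â(ξ_j)) / 2`. -/
def fluxPtMetric (q : InnerPt K p) : Vec3 :=
  ∑ i, ∑ j, if i ≤ q.2.2.2.castSucc ∧ q.2.2.2.castSucc < j then
    (2 * X.sbp.Q i j) • ((1 / 2 : ℝ) •
      (X.mesh.metric q.1 q.2.1 (lineNode q.2.1 q.2.2.1 i) +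
        X.mesh.metric q.1 q.2.1 (lineNode q.2.1 q.2.2.1 j))) else 0

/-- The states on the two sides of an interior flux point. -/
def leftState (U : Grid K p) (q : InnerPt K p) : State :=
  U q.1 (lineNode q.2.1 q.2.2.1 q.2.2.2.castSucc)

def rightState (U : Grid K p) (q : InnerPt K p) : State :=
  U q.1 (lineNode q.2.1 q.2.2.1 q.2.2.2.succ)

/-- Extend inviscid fluxes given at the interior flux points of a line by the contravariant flux
of the end states. -/
def withEnds (U : Grid K p) (k : Fin K) (l : Fin 3) (F : InnerPt K p → State) (b : Tang p) :
    Fin (p + 2) → State :=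
  let e : Fin (p + 1) → State := fun i =>
    X.gas.directedFlux (X.mesh.metric k l (lineNode l b i)) (U k (lineNode l b i))
  Fin.cons (α := fun _ => State) (e 0)
    (Fin.snoc (α := fun _ => State) (fun r => F (k, l, b, r)) (e (Fin.last p)))

/-- Extend fluxes that are defined at interior flux points only by zero. -/
def innerOnly (k : Fin K) (l : Fin 3) (F : InnerPt K p → State) (b : Tang p) :
    Fin (p + 2) → State :=
  Fin.cons (α := fun _ => State) 0
    (Fin.snoc (α := fun _ => State) (fun r => F (k, l, b, r)) 0)

/-- The high-order entropy conservative contravariant inviscid flux at interior flux points. -/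
def highFlux (U : Grid K p) (q : InnerPt K p) : State :=
  let k := q.1
  let l := q.2.1
  let b := q.2.2.1
  ∑ i, ∑ j, if i ≤ q.2.2.2.castSucc ∧ q.2.2.2.castSucc < j then
    (2 * X.sbp.Q i j) • X.ec.directed
      ((1 / 2 : ℝ) • (X.mesh.metric k l (lineNode l b i) + X.mesh.metric k l (lineNode l b j)))
      (U k (lineNode l b i)) (U k (lineNode l b j)) else 0

/-- The Merriam-Roe flux `f^{(MR)} = f^{(EC)} - f^{(ED)}` in the direction `n`. -/
def merriamRoeFlux (n : Vec3) (u v : State) : State :=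
  X.ec.directed n u v -
    (1 / 2 : ℝ) • (X.gas.merriamRoe n (X.avg.roe u v) *ᵥ (X.gas.entropyVar v - X.gas.entropyVar u))

/-- The first-order Merriam-Roe contravariant flux at interior flux points. -/
def lowFlux (U : Grid K p) (q : InnerPt K p) : State :=
  X.merriamRoeFlux (X.fluxPtMetric q) (leftState U q) (rightState U q)

/-- First-order Brenner flux at interior flux points. -/
def brennerLow (c : InnerPt K p → BrennerCoeff) (U : Grid K p) (q : InnerPt K p) : State :=
  brennerTwoPoint X.avg (c q) (X.fluxPtMetric q) (leftState U q) (rightState U q)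

/-- First-order Brenner flux across an interface, in the outward direction. -/
def brennerFace (c : FacePt K p → BrennerCoeff) (U : Grid K p) (f : FacePt K p) : State :=
  brennerTwoPoint X.avg (c f) (X.mesh.normal f) (f.val U) ((X.mesh.nbr f).val U)

/-- The inviscid interface penalty, which replaces the own flux by the Merriam-Roe flux. -/
def inviscidPenalty (U : Grid K p) (f : FacePt K p) : State :=
  X.gas.directedFlux (X.mesh.normal f) (f.val U) -
    X.merriamRoeFlux (X.mesh.normal f) (f.val U) ((X.mesh.nbr f).val U)

/-- The interface penalty in the gradient of the entropy variables. -/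
def gradPenalty (U : Grid K p) (f : FacePt K p) : State :=
  (sideSign f.2.2.1 / 2) • ((X.mesh.nbr f).val (X.w U) - f.val (X.w U))

/-- The discrete gradient `Θ_{x^j}` of the entropy variables. -/
def gradW (U : Grid K p) (k : Fin K) (a : Node p) (j : Fin 3) : State :=
  ∑ l, (X.mesh.metric k l a j / X.mesh.J k a) •
    (X.sbp.diff l (X.w U k) a + X.sbp.penalty (X.gradPenalty U) k l a)

/-- The high-order viscous flux in Cartesian directions. -/
def viscFlux (U : Grid K p) (k : Fin K) (a : Node p) : Fin 3 → State :=
  let u := U k a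
  let T := X.gas.temperature u
  brennerFluxW X.gas (density u) (velocity u) T (specificEnergy u)
    (X.gas.visc T) (X.gas.cond T) 0 (X.gradW U k a)

/-- The high-order artificial dissipation flux in Cartesian directions: the Brenner flux with
`μ = μ^{AD}`, `κ = c_T μ^{AD}` and `σ = c_ρ μ^{AD} / ρ`. -/
def adFlux (c : Coeffs X) (U : Grid K p) (k : Fin K) (a : Node p) : Fin 3 → State :=
  let u := U k a
  brennerFluxW X.gas (density u) (velocity u) (X.gas.temperature u) (specificEnergy u)
    (c.μAD k a) (X.cT * c.μAD k a) (X.cρ * c.μAD k a / density u) (X.gradW U k a)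

/-- `∑_l D_{ξ^l} ∑_m [â^l_m] f_{x^m}`, one summand. -/
def diffFlux (F : Fin K → Node p → Fin 3 → State) (k : Fin K) (l : Fin 3) (a : Node p) : State :=
  X.sbp.diff l (fun a' => ∑ m, X.mesh.metric k l a' m • F k a' m) a

/-- The centered interface penalty of a high-order viscous flux: half the jump of the normal
flux; both normal fluxes are taken in the respective outward directions. -/
def centeredPenalty (F : Fin K → Node p → Fin 3 → State) (f : FacePt K p) : State :=
  -((1 / 2 : ℝ) • (∑ m, X.mesh.normal (X.mesh.nbr f) m • (X.mesh.nbr f).val F m +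
    ∑ m, X.mesh.normal f m • f.val F m))

/-- The interface penalty of the inviscid and viscous terms. -/
def nsPenalty (c : Coeffs X) (U : Grid K p) (f : FacePt K p) : State :=
  X.inviscidPenalty U f + (X.centeredPenalty (X.viscFlux U) f + X.brennerFace c.ipVisc U f)

/-- The baseline high-order scheme `(dÛ/dt)_p`. -/
def rhsHigh (c : Coeffs X) (U : Grid K p) (k : Fin K) (a : Node p) : State :=
  ∑ l, (-X.sbp.fluxDiff l (X.withEnds U k l (X.highFlux U)) a +
    X.diffFlux (X.viscFlux U) k l a + X.sbp.penalty (X.nsPenalty c U) k l a)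

/-- The first-order scheme `(dÛ/dt)_1`. -/
def rhsLow (c : Coeffs X) (U : Grid K p) (k : Fin K) (a : Node p) : State :=
  ∑ l, (-X.sbp.fluxDiff l (X.withEnds U k l (X.lowFlux U)) a +
    X.diffFlux (X.viscFlux U) k l a + X.sbp.penalty (X.nsPenalty c U) k l a)

/-- The artificial dissipation `(dÛ/dt)_{AD}`. -/
def rhsAD (c : Coeffs X) (U : Grid K p) (k : Fin K) (a : Node p) : State :=
  ∑ l, (X.sbp.fluxDiff l (innerOnly k l (fun q =>
      (1 - c.θ k) • X.brennerLow c.mass U q + X.brennerLow c.ad U q)) a +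
    X.diffFlux (X.adFlux c U) k l a +
    X.sbp.penalty (fun f => X.brennerFace c.adFace U f +
      (X.centeredPenalty (X.adFlux c U) f + X.brennerFace c.ipAD U f)) k l a)

/-- The right-hand side of the flux-limiting scheme. -/
def rhs (c : Coeffs X) (U : Grid K p) (k : Fin K) (a : Node p) : State :=
  c.θ k • X.rhsHigh c U k a + (1 - c.θ k) • X.rhsLow c U k a + X.rhsAD c U k a

/-- `U` solves the semi-discrete scheme on `[t 1, t n]` with coefficients that may change in
time: it is continuous, takes admissible values at all solution points, and satisfies
`dÛ/dt = rhs`, `Û = J U`, except possibly at the time levels `t i`. -/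
structure IsSolution (coef : ℝ → Coeffs X) (t : ℕ → ℝ) (n : ℕ) (U : ℝ → Grid K p) : Prop where
  continuousOn : ContinuousOn U (Set.Icc (t 1) (t n))
  admissible : ∀ s ∈ Set.Icc (t 1) (t n), ∀ k a, X.gas.Admissible (U s k a)
  equation : ∀ s ∈ Set.Ioo (t 1) (t n), (∀ i, s ≠ t i) → ∀ k a,
    HasDerivAt (fun s' => X.mesh.J k a • U s' k a) (X.rhs (coef s) (U s) k a) s

/-! ## Discrete functionals -/

/-- `∑_k 1ᵀ 𝒫 φ_k`. -/
def sum {V : Type} [AddCommGroup V] [Module ℝ V] (φ : Fin K → Node p → V) : V :=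
  ∑ k, ∑ a, X.sbp.weight a • φ k a

/-- `∑_k 1ᵀ 𝒫 [J]_k φ_k`. -/
def integral (φ : Fin K → Node p → ℝ) : ℝ := X.sum fun k a => X.mesh.J k a * φ k a

/-- The discrete relative entropy `∑_k 1ᵀ 𝒫 Ŝ̄_k`. -/
def totalRelEntropy (u₀ : State) (U : Grid K p) : ℝ :=
  X.integral fun k a => X.gas.relEntropy u₀ (U k a)

/-- The total entropy dissipation `𝒟`; without boundary contributions it is
`-∑_k w_kᵀ 𝒫 dÛ_k/dt`. -/
def dissipation (c : Coeffs X) (U : Grid K p) : ℝ :=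
  -X.sum fun k a => X.w U k a ⬝ᵥ X.rhs c U k a

/-- The dissipation averaged over the time step `[t^i, t^{i+1}]`. -/
def meanDissipation (coef : ℝ → Coeffs X) (U : ℝ → Grid K p) (t : ℕ → ℝ) (i : ℕ) : ℝ :=
  (t (i + 1) - t i)⁻¹ * ∫ s in (t i)..(t (i + 1)), X.dissipation (coef s) (U s)

/-- `𝒞^{n-1} = ∑_k 1ᵀ 𝒫 Ŝ̄_k^1 - ∑_{i=1}^{n-1} τ^i 𝒟̄^i`. -/
def entropyBudget (coef : ℝ → Coeffs X) (U : ℝ → Grid K p) (t : ℕ → ℝ) (u₀ : State) (n : ℕ) : ℝ :=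
  X.totalRelEntropy u₀ (U (t 1)) -
    ∑ i ∈ Finset.Ico 1 n, (t (i + 1) - t i) * X.meanDissipation coef U t i

/-- `Ũ` collects intermediate states of the second-order Taylor expansion of the entropy about
`u₀`, one for every solution point. -/
def IsTaylor (u₀ : State) (U Ũ : Grid K p) : Prop :=
  ∀ k a, Ũ k a ∈ segment ℝ u₀ (U k a) ∧ X.gas.Admissible (Ũ k a) ∧
    X.gas.entropy (U k a) = X.gas.entropy u₀ + X.gas.entropyVar u₀ ⬝ᵥ (U k a - u₀) +
      1 / 2 * ((U k a - u₀) ⬝ᵥ (X.gas.entropyHessian (Ũ k a) *ᵥ (U k a - u₀)))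

end Scheme

namespace Gas

/-- `b₁ = ρ / R`. -/
def bDensity (g : Gas) (u : State) : ℝ := density u / g.R

/-- `b_{i+1} = (P + ρ V_i²) / R`, `i = 1, 2, 3`. -/
def bMomentum (g : Gas) (i : Fin 3) (u : State) : ℝ :=
  (g.pressure u + density u * velocity u i ^ 2) / g.R

/-- `b₅ = (γ P² / (γ - 1)² + γ P ρ |V|² / (γ - 1) + (ρ |V|² / 2)²) / (R ρ)`. -/
def bEnergy (g : Gas) (u : State) : ℝ :=
  (g.γ * g.pressure u ^ 2 / (g.γ - 1) ^ 2 +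
    g.γ * g.pressure u * density u * (∑ i, velocity u i ^ 2) / (g.γ - 1) +
    (density u * (∑ i, velocity u i ^ 2) / 2) ^ 2) / (g.R * density u)

end Gas

end

end FluxLim

/-!
The dissipation estimate is a statement about one instant. Summation by parts on every grid line
writes the pairing of the right-hand side with a grid function `φ` as a sum over interior flux
points of `Δφ` times the flux there, a sum over face points of `φ` times a numerical interface
flux, and minus a volume term in `D φ` (`Scheme.sum_dotProduct_rhs`). The interface flux is
antisymmetric under exchange of the two sides (`Scheme.faceFlux_nbr`; reversing the normal leaves
the Merriam-Roe matrix unchanged), so only the jump of `φ` enters. For constant `φ` everything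
vanishes, which is conservation.

For `φ = w` the high-order and the first-order inviscid flux have, line by line, entropy production
equal to, respectively at most, the increments of the potential flux contracted with the same metric
terms at the flux points (`Scheme.sum_highFlux_line`, `Scheme.lowFlux_le`). Hence any limiter that
is constant on an element preserves the estimate. By the geometric conservation law these increments
reduce to interface values (`Scheme.innerSum_potentialJump`), which cancel against the
conservative part of the Merriam-Roe interface flux; the remaining part is dissipative.
The discrete gradient is dual to the divergence with centered interface fluxes
(`Scheme.volumeTerm_add_faceSum`), and the Brenner flux is a positive semidefinite linear function
of the gradient of the entropy variables (`brennerFluxW_nonneg`), so all viscous terms dissipate.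

In time, the discrete relative entropy has derivative `-𝒟` between the time levels. A derivative of
constant sign of a continuous function is integrable, so no regularity of the coefficients in time
is needed, and the fundamental theorem of calculus shows that the relative entropy at the last level
equals the entropy budget (`Scheme.IsSolution.totalRelEntropy_eq_entropyBudget`).

The bounds on the solution come from the second variation of the entropy,
`R dρ² / ρ + ρ |dV|² / T + c_v ρ (dT / T)²` (`Gas.Admissible.quadForm_eq`). It is positive definite,
the admissible set is convex, and the relative entropy is half this form at an
intermediate state. The numbers `b_j` are the diagonal entries of the inverse Hessian, and the
componentwise bounds are the Cauchy-Schwarz inequality with respect to the Hessian.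
-/

open scoped Matrix

namespace FluxLim

noncomputable section

/-! ### Derivatives of the entropy -/

lemma density_add_smul (u x : State) (s : ℝ) : density (u + s • x) = density u + s * density x := by
  simp [density]

lemma momentum_add_smul (u x : State) (s : ℝ) (i : Fin 3) :
    momentum (u + s • x) i = momentum u i + s * momentum x i := by
  simp [momentum]

lemma totalEnergy_add_smul (u x : State) (s : ℝ) :
    totalEnergy (u + s • x) = totalEnergy u + s * totalEnergy x := by
  simp [totalEnergy]

/-- The derivative of the internal energy at `u` in the direction `x`, for nonzero density. -/
def internalEnergyDeriv (u x : State) : ℝ :=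
  totalEnergy x - (∑ i, momentum u i * momentum x i) / density u +
    (∑ i, momentum u i ^ 2) * density x / (2 * density u ^ 2)

/-- The derivative of the entropy at an admissible `u` in the direction `x`; the last term collects
the derivatives of the logarithms of the density. -/
def entropyDeriv (g : Gas) (u x : State) : ℝ :=
  -(density x * g.specificEntropy u) -
    g.R / (g.γ - 1) * (density u * internalEnergyDeriv u x / internalEnergy u) +
    (g.R / (g.γ - 1) + g.R) * density x

/-- The variation of the velocity, `dV = (dm - V dρ) / ρ`. -/
def velocityVar (u x : State) (i : Fin 3) : ℝ :=
  (momentum x i - velocity u i * density x) / density u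

/-- The logarithmic variation of the temperature, `dT / T = de / e - dρ / ρ`. -/
def logTempVar (u x : State) : ℝ :=
  internalEnergyDeriv u x / internalEnergy u - density x / density u

/-- The second variation of the entropy as a sum of squares,
`R dρ² / ρ + ρ |dV|² / T + c_v ρ (dT / T)²`. -/
def entropySecond (g : Gas) (u x : State) : ℝ :=
  g.R / density u * density x ^ 2 +
    density u / g.temperature u * ∑ i, velocityVar u x i ^ 2 +
    g.R / (g.γ - 1) * density u * logTempVar u x ^ 2

namespace Gas
variable {g : Gas} {u : State}

lemma cv_pos (g : Gas) : 0 < g.R / (g.γ - 1) := div_pos g.R_pos (sub_pos.2 g.one_lt_γ)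

/-- `e = c_v ρ T`; at zero density both sides are zero by the convention for division. -/
lemma temperature_eq (g : Gas) (u : State) :
    g.temperature u = internalEnergy u / (g.R / (g.γ - 1) * density u) := by
  have h := g.R_pos.ne'
  have h2 := (sub_pos.2 g.one_lt_γ).ne'
  rw [temperature, pressure]
  by_cases hd : density u = 0
  · simp [hd]
  · field_simp

lemma admissible_iff (g : Gas) (u : State) :
    g.Admissible u ↔ 0 < density u ∧ 0 < internalEnergy u := by
  refine and_congr_right fun hd => ?_
  rw [temperature_eq, div_pos_iff_of_pos_right (mul_pos g.cv_pos hd)]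

lemma Admissible.density_pos (h : g.Admissible u) : 0 < density u := h.1
lemma Admissible.temperature_pos (h : g.Admissible u) : 0 < g.temperature u := h.2
lemma Admissible.internalEnergy_pos (h : g.Admissible u) : 0 < internalEnergy u :=
  ((admissible_iff g u).1 h).2

end Gas

lemma hasDerivAt_density_line (u x : State) :
    HasDerivAt (fun s : ℝ => density (u + s • x)) (density x) 0 := by
  simp only [density_add_smul]
  simpa using ((hasDerivAt_id (0 : ℝ)).mul_const (density x)).const_add (density u)

lemma hasDerivAt_momentum_line (u x : State) (i : Fin 3) :
    HasDerivAt (fun s : ℝ => momentum (u + s • x) i) (momentum x i) 0 := by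
  simp only [momentum_add_smul]
  simpa using ((hasDerivAt_id (0 : ℝ)).mul_const (momentum x i)).const_add (momentum u i)

lemma hasDerivAt_totalEnergy_line (u x : State) :
    HasDerivAt (fun s : ℝ => totalEnergy (u + s • x)) (totalEnergy x) 0 := by
  simp only [totalEnergy_add_smul]
  simpa using ((hasDerivAt_id (0 : ℝ)).mul_const (totalEnergy x)).const_add (totalEnergy u)

lemma hasDerivAt_internalEnergy_line {u : State} (x : State) (hu : density u ≠ 0) :
    HasDerivAt (fun s : ℝ => internalEnergy (u + s • x)) (internalEnergyDeriv u x) 0 := by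
  have h := (hasDerivAt_totalEnergy_line u x).sub
    ((HasDerivAt.fun_sum fun i (_ : i ∈ Finset.univ) => (hasDerivAt_momentum_line u x i).pow 2).div
      ((hasDerivAt_density_line u x).const_mul 2) (by simpa using hu))
  refine h.congr_deriv ?_
  simp only [internalEnergyDeriv, Fin.sum_univ_three, zero_smul, add_zero, Pi.pow_apply]
  field_simp
  ring

lemma hasDerivAt_internalEnergyDeriv_line {u : State} (x : State) (hu : density u ≠ 0) :
    HasDerivAt (fun s : ℝ => internalEnergyDeriv (u + s • x) x)
      (-(density u * ∑ i, velocityVar u x i ^ 2)) 0 := by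
  have h := (((HasDerivAt.fun_sum fun i (_ : i ∈ Finset.univ) =>
      (hasDerivAt_momentum_line u x i).mul_const (momentum x i)).div
      (hasDerivAt_density_line u x) (by simpa using hu)).const_sub (totalEnergy x)).add
    (((HasDerivAt.fun_sum fun i (_ : i ∈ Finset.univ) =>
      (hasDerivAt_momentum_line u x i).pow 2).mul_const (density x)).div
      (((hasDerivAt_density_line u x).pow 2).const_mul 2) (by simpa using hu))
  refine h.congr_deriv ?_
  simp only [velocityVar, velocity, Fin.sum_univ_three, zero_smul, add_zero, Pi.pow_apply]
  field_simp
  ring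

namespace Gas
variable {g : Gas} {u : State}

lemma Admissible.specificEntropy_eq (h : g.Admissible u) :
    g.specificEntropy u = g.R / (g.γ - 1) * (Real.log (internalEnergy u) -
      Real.log (g.R / (g.γ - 1)) - Real.log (density u)) - g.R * Real.log (density u) := by
  rw [specificEntropy, temperature_eq, Real.log_div h.internalEnergy_pos.ne'
    (mul_pos g.cv_pos h.density_pos).ne', Real.log_mul g.cv_pos.ne' h.density_pos.ne']
  ring

lemma contDiff_density : ContDiff ℝ 2 density := by unfold density; fun_prop

lemma contDiffAt_internalEnergy {u : State} (hu : density u ≠ 0) :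
    ContDiffAt ℝ 2 internalEnergy u := by
  unfold internalEnergy
  refine ContDiffAt.sub ?_ (ContDiffAt.div ?_ ?_ ?_)
  · unfold totalEnergy; fun_prop
  · unfold momentum; fun_prop
  · exact contDiffAt_const.mul contDiff_density.contDiffAt
  · simpa using hu

lemma Admissible.eventually (h : g.Admissible u) : ∀ᶠ v in nhds u, g.Admissible v := by
  simp only [admissible_iff]
  have hd := contDiff_density.contDiffAt (x := u)
  exact (hd.continuousAt.eventually (lt_mem_nhds h.density_pos)).and
    ((contDiffAt_internalEnergy h.density_pos.ne').continuousAt.eventually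
      (lt_mem_nhds h.internalEnergy_pos))

lemma Admissible.eventually_line (h : g.Admissible u) (x : State) :
    ∀ᶠ s : ℝ in nhds 0, g.Admissible (u + s • x) := by
  have hc : ContinuousAt (fun s : ℝ => u + s • x) 0 := by fun_prop
  exact hc.eventually (by simpa using h.eventually)

lemma Admissible.hasDerivAt_specificEntropy_line (h : g.Admissible u) (x : State) :
    HasDerivAt (fun s : ℝ => g.specificEntropy (u + s • x))
      (g.R / (g.γ - 1) * logTempVar u x - g.R * (density x / density u)) 0 := by
  have hd := (hasDerivAt_density_line u x).log (by simpa using h.density_pos.ne')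
  have he := (hasDerivAt_internalEnergy_line x h.density_pos.ne').log
    (by simpa using h.internalEnergy_pos.ne')
  have h1 := (((he.sub_const (Real.log (g.R / (g.γ - 1)))).sub hd).const_mul
    (g.R / (g.γ - 1))).sub (hd.const_mul g.R)
  refine (h1.congr_deriv ?_).congr_of_eventuallyEq ?_
  · simp [logTempVar]
  · filter_upwards [h.eventually_line x] with s hs
    simpa using hs.specificEntropy_eq

lemma Admissible.hasDerivAt_entropy_line (h : g.Admissible u) (x : State) :
    HasDerivAt (fun s : ℝ => g.entropy (u + s • x)) (entropyDeriv g u x) 0 := by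
  have h1 := ((hasDerivAt_density_line u x).mul (h.hasDerivAt_specificEntropy_line x)).neg
  refine h1.congr_deriv ?_
  have := h.density_pos.ne'
  have := h.internalEnergy_pos.ne'
  simp only [zero_smul, add_zero, logTempVar, entropyDeriv]
  field_simp
  ring

lemma Admissible.hasDerivAt_entropyDeriv_line (h : g.Admissible u) (x : State) :
    HasDerivAt (fun s : ℝ => entropyDeriv g (u + s • x) x) (entropySecond g u x) 0 := by
  have hd := h.density_pos.ne'
  have he := h.internalEnergy_pos.ne'
  have h1 := (((h.hasDerivAt_specificEntropy_line x).const_mul (density x)).neg.sub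
    ((((hasDerivAt_density_line u x).mul (hasDerivAt_internalEnergyDeriv_line x hd)).div
      (hasDerivAt_internalEnergy_line x hd) (by simpa using he)).const_mul
        (g.R / (g.γ - 1)))).add_const ((g.R / (g.γ - 1) + g.R) * density x)
  refine h1.congr_deriv ?_
  have hR := g.R_pos.ne'
  have hg := (sub_pos.2 g.one_lt_γ).ne'
  simp only [zero_smul, add_zero, entropySecond, temperature_eq, logTempVar, Pi.mul_apply]
  generalize ∑ i, velocityVar u x i ^ 2 = q
  field_simp
  ring

lemma Admissible.contDiffAt_entropy (h : g.Admissible u) : ContDiffAt ℝ 2 g.entropy u := by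
  have hd := h.density_pos.ne'
  have ht := h.temperature_pos.ne'
  have h0 := contDiff_density.contDiffAt (x := u)
  have hT : ContDiffAt ℝ 2 g.temperature u :=
    (contDiffAt_const.mul (contDiffAt_internalEnergy hd)).div (h0.mul contDiffAt_const)
      (mul_ne_zero hd g.R_pos.ne')
  unfold entropy specificEntropy
  exact (h0.mul ((contDiffAt_const.mul (hT.log ht)).sub (contDiffAt_const.mul (h0.log hd)))).neg

end Gas

lemma hasDerivAt_comp_line {E F : Type*} [NormedAddCommGroup E] [NormedSpace ℝ E]
    [NormedAddCommGroup F] [NormedSpace ℝ F] {f : E → F} {u x : E} {s : ℝ}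
    (h : DifferentiableAt ℝ f (u + s • x)) :
    HasDerivAt (fun t : ℝ => f (u + t • x)) (fderiv ℝ f (u + s • x) x) s := by
  have hl : HasDerivAt (fun t : ℝ => u + t • x) x s := by
    simpa using ((hasDerivAt_id s).smul_const x).const_add u
  exact h.hasFDerivAt.comp_hasDerivAt s hl

lemma hasDerivAt_fderiv_comp_line {E : Type*} [NormedAddCommGroup E] [NormedSpace ℝ E]
    {f : E → ℝ} {u x : E} {s : ℝ} (h : DifferentiableAt ℝ (fderiv ℝ f) (u + s • x)) :
    HasDerivAt (fun t : ℝ => fderiv ℝ f (u + t • x) x)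
      (fderiv ℝ (fderiv ℝ f) (u + s • x) x x) s := by
  simpa using (hasDerivAt_comp_line h).clm_apply (hasDerivAt_const s x)

namespace Gas
variable {g : Gas} {u : State}

/-- No differentiability is needed: `entropyVar` is read off from the same linear map. -/
lemma fderiv_entropy_apply (g : Gas) (u x : State) :
    fderiv ℝ g.entropy u x = g.entropyVar u ⬝ᵥ x := by
  conv_lhs => rw [pi_eq_sum_univ' x]
  simp [dotProduct, entropyVar, mul_comm]

lemma Admissible.differentiableAt_entropy (h : g.Admissible u) :
    DifferentiableAt ℝ g.entropy u :=
  h.contDiffAt_entropy.differentiableAt (by norm_num)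

lemma Admissible.differentiableAt_fderiv_entropy (h : g.Admissible u) :
    DifferentiableAt ℝ (fderiv ℝ g.entropy) u :=
  (h.contDiffAt_entropy.fderiv_right (m := 1) (by norm_num)).differentiableAt (by norm_num)

lemma Admissible.entropyVar_dotProduct (h : g.Admissible u) (x : State) :
    g.entropyVar u ⬝ᵥ x = entropyDeriv g u x := by
  rw [← fderiv_entropy_apply]
  have h1 := hasDerivAt_comp_line (f := g.entropy) (u := u) (x := x) (s := 0)
    (by simpa using h.differentiableAt_entropy)
  rw [zero_smul, add_zero] at h1
  exact h1.unique (h.hasDerivAt_entropy_line x)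

lemma Admissible.entropyHessian_apply (h : g.Admissible u) (i j : Fin 5) :
    g.entropyHessian u i j =
      fderiv ℝ (fderiv ℝ g.entropy) u (Pi.single i 1) (Pi.single j 1) := by
  simp only [entropyHessian, Matrix.of_apply, entropyVar]
  rw [fderiv_clm_apply h.differentiableAt_fderiv_entropy (by fun_prop)]
  simp

lemma Admissible.dotProduct_entropyHessian (h : g.Admissible u) (x y : State) :
    x ⬝ᵥ (g.entropyHessian u *ᵥ y) = fderiv ℝ (fderiv ℝ g.entropy) u x y := by
  have hx : x = ∑ i, x i • (Pi.single i 1 : State) := by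
    ext j; simp [Finset.sum_apply, Pi.single_apply]
  have hy : y = ∑ i, y i • (Pi.single i 1 : State) := by
    ext j; simp [Finset.sum_apply, Pi.single_apply]
  conv_rhs => rw [hx, hy]
  simp only [map_sum, map_smul, _root_.sum_apply, _root_.smul_apply,
    ← h.entropyHessian_apply, smul_eq_mul, dotProduct, Matrix.mulVec, Finset.mul_sum]
  rw [Finset.sum_comm]
  exact Finset.sum_congr rfl fun _ _ => Finset.sum_congr rfl fun _ _ => by ring

lemma Admissible.entropyHessian_isHermitian (h : g.Admissible u) :
    (g.entropyHessian u).IsHermitian := by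
  have hs : IsSymmSndFDerivAt ℝ g.entropy u :=
    h.contDiffAt_entropy.isSymmSndFDerivAt (by simp)
  ext i j
  simp only [Matrix.conjTranspose_apply, star_trivial, h.entropyHessian_apply]
  exact hs _ _

/-- The Hessian is the second derivative of the entropy along a line, which has been computed as
a sum of squares. -/
lemma Admissible.quadForm_eq (h : g.Admissible u) (x : State) :
    x ⬝ᵥ (g.entropyHessian u *ᵥ x) = entropySecond g u x := by
  rw [h.dotProduct_entropyHessian]
  have h1 := hasDerivAt_fderiv_comp_line (f := g.entropy) (u := u) (x := x) (s := 0)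
    (by simpa using h.differentiableAt_fderiv_entropy)
  rw [zero_smul, add_zero] at h1
  refine h1.unique ((h.hasDerivAt_entropyDeriv_line x).congr_of_eventuallyEq ?_)
  filter_upwards [h.eventually_line x] with s hs
  rw [fderiv_entropy_apply, hs.entropyVar_dotProduct]

lemma Admissible.quadForm_pos (h : g.Admissible u) {x : State} (hx : x ≠ 0) :
    0 < x ⬝ᵥ (g.entropyHessian u *ᵥ x) := by
  rw [h.quadForm_eq, entropySecond]
  have hd := h.density_pos
  have hT := h.temperature_pos
  have hR := g.R_pos
  have hc := g.cv_pos
  have he := h.internalEnergy_pos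
  have h1 : 0 ≤ g.R / density u * density x ^ 2 := by positivity
  have h2 : 0 ≤ density u / g.temperature u * ∑ i, velocityVar u x i ^ 2 := by positivity
  have h3 : 0 ≤ g.R / (g.γ - 1) * density u * logTempVar u x ^ 2 := by positivity
  by_contra hn
  refine hx ?_
  have e1 : density x = 0 := by
    have : g.R / density u * density x ^ 2 = 0 := by linarith
    simpa [hR.ne', hd.ne'] using this
  have e2 : ∀ i, momentum x i = 0 := by
    have h2' : density u / g.temperature u * ∑ i, velocityVar u x i ^ 2 = 0 := by linarith
    have h2'' : ∑ i, velocityVar u x i ^ 2 = 0 := by simpa [hT.ne', hd.ne'] using h2'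
    intro i
    have := (Finset.sum_eq_zero_iff_of_nonneg fun i _ => sq_nonneg _).1 h2'' i (Finset.mem_univ i)
    simpa [velocityVar, e1, hd.ne'] using this
  have e3 : totalEnergy x = 0 := by
    have h3' : g.R / (g.γ - 1) * density u * logTempVar u x ^ 2 = 0 := by linarith
    have : logTempVar u x ^ 2 = 0 := by
      simpa only [mul_eq_zero, hc.ne', hd.ne', false_or] using h3'
    simpa [logTempVar, e1, e2, internalEnergyDeriv, he.ne'] using this
  funext i
  fin_cases i
  exacts [e1, e2 0, e2 1, e2 2, e3]

lemma Admissible.quadForm_nonneg (h : g.Admissible u) (x : State) :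
    0 ≤ x ⬝ᵥ (g.entropyHessian u *ᵥ x) := by
  by_cases hx : x = 0
  · simp [hx]
  · exact (h.quadForm_pos hx).le

/-! ### Convexity of the admissible set and the Taylor expansion of the entropy -/

/-- The internal energy is concave on `ρ > 0`, being the total energy minus the jointly convex
kinetic energy. -/
lemma convex_setOf_admissible (g : Gas) : Convex ℝ {u | g.Admissible u} := by
  intro u hu v hv a b ha hb hab
  have hu := (admissible_iff g u).1 hu
  have hv := (admissible_iff g v).1 hv
  refine (admissible_iff g _).2 ?_
  have ed : density (a • u + b • v) = a * density u + b * density v := by simp [density]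
  have em : ∀ i, momentum (a • u + b • v) i = a * momentum u i + b * momentum v i := by
    simp [momentum]
  have eE : totalEnergy (a • u + b • v) = a * totalEnergy u + b * totalEnergy v := by
    simp [totalEnergy]
  obtain ⟨du, iu⟩ := hu
  obtain ⟨dv, iv⟩ := hv
  have comb : ∀ {r s : ℝ}, 0 < r → 0 < s → 0 < a * r + b * s := by
    intro r s hr hs
    rcases ha.eq_or_lt with rfl | ha
    · have : b = 1 := by linarith
      subst this; simpa using hs
    · have := mul_pos ha hr
      have := mul_nonneg hb hs.le
      linarith
  have hD := comb du dv
  refine ⟨ed ▸ hD, ?_⟩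
  -- the kinetic energy `|m|² / (2ρ)` is jointly convex
  have key : ∀ i, (a * momentum u i + b * momentum v i) ^ 2 / (2 * (a * density u + b * density v))
      ≤ a * (momentum u i ^ 2 / (2 * density u)) + b * (momentum v i ^ 2 / (2 * density v)) := by
    intro i
    rw [div_le_iff₀ (by positivity), ← sub_nonneg]
    have : (a * (momentum u i ^ 2 / (2 * density u)) + b * (momentum v i ^ 2 / (2 * density v))) *
        (2 * (a * density u + b * density v)) - (a * momentum u i + b * momentum v i) ^ 2 =
        a * b * (momentum u i * density v - momentum v i * density u) ^ 2 /
          (density u * density v) := by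
      field_simp
      ring
    rw [this]
    positivity
  have := comb iu iv
  have hk := Finset.sum_le_sum fun i (_ : i ∈ (Finset.univ : Finset (Fin 3))) => key i
  simp only [internalEnergy, ed, em, eE, Finset.sum_div] at this ⊢
  simp only [Finset.sum_add_distrib, ← Finset.mul_sum] at hk
  linarith

/-- Taylor's formula with Lagrange remainder along the segment from `u₀` to `u`, all of whose points
are admissible. -/
lemma exists_taylor {u₀ u : State} (h₀ : g.Admissible u₀) (h : g.Admissible u) :
    ∃ v ∈ segment ℝ u₀ u, g.Admissible v ∧
      g.entropy u = g.entropy u₀ + g.entropyVar u₀ ⬝ᵥ (u - u₀) +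
        1 / 2 * ((u - u₀) ⬝ᵥ (g.entropyHessian v *ᵥ (u - u₀))) := by
  set x := u - u₀ with hx
  have hseg : ∀ s ∈ Set.Icc (0 : ℝ) 1, u₀ + s • x ∈ segment ℝ u₀ u := fun s hs => by
    rw [segment_eq_image']; exact ⟨s, hs, rfl⟩
  have hadm : ∀ s ∈ Set.Icc (0 : ℝ) 1, g.Admissible (u₀ + s • x) := fun s hs =>
    (convex_setOf_admissible g).segment_subset h₀ h (hseg s hs)
  have d1 : ∀ s ∈ Set.Icc (0 : ℝ) 1, HasDerivAt (fun s : ℝ => g.entropy (u₀ + s • x))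
      (fderiv ℝ g.entropy (u₀ + s • x) x) s := fun s hs =>
    hasDerivAt_comp_line (hadm s hs).differentiableAt_entropy
  have d2 : ∀ s ∈ Set.Icc (0 : ℝ) 1, HasDerivAt (fun s : ℝ => fderiv ℝ g.entropy (u₀ + s • x) x)
      (x ⬝ᵥ (g.entropyHessian (u₀ + s • x) *ᵥ x)) s := fun s hs => by
    rw [(hadm s hs).dotProduct_entropyHessian]
    exact hasDerivAt_fderiv_comp_line (hadm s hs).differentiableAt_fderiv_entropy
  -- Cauchy's mean value theorem for the remainder expanded at `s`, against `(1 - s)²`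
  have d3 : ∀ s ∈ Set.Icc (0 : ℝ) 1, HasDerivAt
      (fun s : ℝ => g.entropy (u₀ + s • x) + (1 - s) * fderiv ℝ g.entropy (u₀ + s • x) x)
      ((1 - s) * (x ⬝ᵥ (g.entropyHessian (u₀ + s • x) *ᵥ x))) s := fun s hs => by
    refine ((d1 s hs).add (((hasDerivAt_id s).const_sub 1).mul (d2 s hs))).congr_deriv ?_
    simp
  have d4 : ∀ s : ℝ, HasDerivAt (fun s : ℝ => (1 - s) ^ 2) (-2 * (1 - s)) s := fun s => by
    refine (((hasDerivAt_id s).const_sub 1).pow 2).congr_deriv ?_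
    simp
  obtain ⟨c, hc, e⟩ := exists_ratio_hasDerivAt_eq_ratio_slope _ _ one_pos
    (fun s hs => (d3 s hs).continuousAt.continuousWithinAt)
    (fun s hs => d3 s ⟨hs.1.le, hs.2.le⟩) _ _
    (fun s _ => (d4 s).continuousAt.continuousWithinAt) (fun s _ => d4 s)
  have hc' : c ∈ Set.Icc (0 : ℝ) 1 := ⟨hc.1.le, hc.2.le⟩
  refine ⟨_, hseg c hc', hadm c hc', ?_⟩
  have h1c : 1 - c ≠ 0 := by linarith [hc.2]
  have hu : u₀ + (1 : ℝ) • x = u := by simp [hx]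
  rw [hu] at e
  simp only [zero_smul, add_zero, sub_self, zero_mul, sub_zero, one_mul,
    fderiv_entropy_apply] at e
  have : (1 - c) * (x ⬝ᵥ (g.entropyHessian (u₀ + c • x) *ᵥ x) -
      2 * (g.entropy u - (g.entropy u₀ + g.entropyVar u₀ ⬝ᵥ x))) = 0 := by linarith
  have := (mul_eq_zero.1 this).resolve_left h1c
  linarith

/-! ### Lower bounds of the entropy Hessian -/

lemma Admissible.pressure_eq (h : g.Admissible u) :
    g.pressure u = density u * g.R * g.temperature u := by
  rw [temperature]
  have := h.density_pos.ne'
  have := g.R_pos.ne'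
  field_simp

lemma Admissible.pressure_pos (h : g.Admissible u) : 0 < g.pressure u := by
  rw [h.pressure_eq]
  exact mul_pos (mul_pos h.density_pos g.R_pos) h.temperature_pos

lemma Admissible.bDensity_pos (h : g.Admissible u) : 0 < g.bDensity u :=
  div_pos h.density_pos g.R_pos

lemma Admissible.bMomentum_pos (h : g.Admissible u) (i : Fin 3) : 0 < g.bMomentum i u :=
  div_pos (add_pos_of_pos_of_nonneg h.pressure_pos
    (mul_nonneg h.density_pos.le (sq_nonneg _))) g.R_pos

lemma Admissible.bEnergy_pos (h : g.Admissible u) : 0 < g.bEnergy u := by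
  have := h.pressure_pos
  have := h.density_pos
  have := g.R_pos
  have : 0 < g.γ - 1 := sub_pos.2 g.one_lt_γ
  have : 0 < g.γ := by linarith
  unfold bEnergy
  positivity

lemma Admissible.density_sq_div_le (h : g.Admissible u) (x : State) :
    density x ^ 2 / g.bDensity u ≤ x ⬝ᵥ (g.entropyHessian u *ᵥ x) := by
  rw [h.quadForm_eq, entropySecond, bDensity]
  have := h.density_pos
  have := h.temperature_pos
  have := g.cv_pos
  have h2 : 0 ≤ density u / g.temperature u * ∑ i, velocityVar u x i ^ 2 := by positivity
  have h3 : 0 ≤ g.R / (g.γ - 1) * density u * logTempVar u x ^ 2 := by positivity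
  have h1 : density x ^ 2 / (density u / g.R) = g.R / density u * density x ^ 2 := by
    field_simp
  linarith

/-- The weighted Cauchy-Schwarz inequality for finitely many terms. -/
lemma sq_sum_le_of_pos {ι : Type*} (s : Finset ι) (c a y : ι → ℝ) (ha : ∀ i ∈ s, 0 < a i) :
    (∑ i ∈ s, c i * y i) ^ 2 ≤ (∑ i ∈ s, c i ^ 2 / a i) * ∑ i ∈ s, a i * y i ^ 2 := by
  refine Finset.sum_sq_le_sum_mul_sum_of_sq_le_mul s (fun i hi => ?_) (fun i hi => ?_)
    fun i hi => ?_
  · have := ha i hi; positivity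
  · have := ha i hi; positivity
  · have := (ha i hi).ne'; exact le_of_eq (by field_simp)

/-- With `dm_i = V_i dρ + ρ dV_i`, this is the Cauchy-Schwarz inequality in the weights of the
second variation of the entropy. -/
lemma Admissible.momentum_sq_div_le (h : g.Admissible u) (x : State) (i : Fin 3) :
    momentum x i ^ 2 / g.bMomentum i u ≤ x ⬝ᵥ (g.entropyHessian u *ᵥ x) := by
  rw [div_le_iff₀ (h.bMomentum_pos i), h.quadForm_eq, entropySecond, bMomentum, h.pressure_eq]
  have hd := h.density_pos
  have hT := h.temperature_pos
  have hc := g.cv_pos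
  have hR := g.R_pos
  have e : momentum x i = velocity u i * density x + density u * velocityVar u x i := by
    rw [velocityVar]; field_simp; ring
  have cs := sq_sum_le_of_pos Finset.univ ![velocity u i, density u]
    ![g.R / density u, density u / g.temperature u] ![density x, velocityVar u x i]
    (by intro j _; fin_cases j <;> simp <;> positivity)
  simp only [Fin.sum_univ_two, Matrix.cons_val_zero, Matrix.cons_val_one] at cs
  have h2 : density u / g.temperature u * velocityVar u x i ^ 2 ≤
      density u / g.temperature u * ∑ i, velocityVar u x i ^ 2 :=
    mul_le_mul_of_nonneg_left (Finset.single_le_sum (f := fun i => velocityVar u x i ^ 2)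
      (fun i _ => sq_nonneg _) (Finset.mem_univ i)) (by positivity)
  have h3 : 0 ≤ g.R / (g.γ - 1) * density u * logTempVar u x ^ 2 := by positivity
  rw [← e] at cs
  have hb : velocity u i ^ 2 / (g.R / density u) + density u ^ 2 / (density u / g.temperature u) =
      (density u * g.R * g.temperature u + density u * velocity u i ^ 2) / g.R := by
    field_simp; ring
  rw [hb, mul_comm] at cs
  refine cs.trans (mul_le_mul_of_nonneg_right (by linarith) (by positivity))

lemma Admissible.totalEnergy_sq_div_le (h : g.Admissible u) (x : State) :
    totalEnergy x ^ 2 / g.bEnergy u ≤ x ⬝ᵥ (g.entropyHessian u *ᵥ x) := by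
  rw [div_le_iff₀ h.bEnergy_pos, h.quadForm_eq, entropySecond, bEnergy, h.pressure_eq]
  have hd := h.density_pos
  have hT := h.temperature_pos
  have hc := g.cv_pos
  have hR := g.R_pos
  have hg : 0 < g.γ - 1 := sub_pos.2 g.one_lt_γ
  have he : internalEnergy u = g.R / (g.γ - 1) * density u * g.temperature u := by
    rw [temperature_eq]; field_simp
  have hE : totalEnergy u = g.R / (g.γ - 1) * density u * g.temperature u +
      density u * (∑ i, velocity u i ^ 2) / 2 := by
    rw [← he, internalEnergy]; simp only [velocity, Fin.sum_univ_three]; field_simp; ring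
  -- the variation of the total energy in terms of those of density, velocity and temperature
  have e : totalEnergy x = totalEnergy u / density u * density x +
      density u * velocity u 0 * velocityVar u x 0 + density u * velocity u 1 * velocityVar u x 1 +
      density u * velocity u 2 * velocityVar u x 2 +
      g.R / (g.γ - 1) * density u * g.temperature u * logTempVar u x := by
    rw [hE, logTempVar, he]
    simp only [velocityVar, velocity, internalEnergyDeriv, Fin.sum_univ_three]; field_simp; ring
  have cs := sq_sum_le_of_pos Finset.univ
    ![totalEnergy u / density u, density u * velocity u 0, density u * velocity u 1,
      density u * velocity u 2, g.R / (g.γ - 1) * density u * g.temperature u]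
    ![g.R / density u, density u / g.temperature u, density u / g.temperature u,
      density u / g.temperature u, g.R / (g.γ - 1) * density u]
    ![density x, velocityVar u x 0, velocityVar u x 1, velocityVar u x 2, logTempVar u x]
    (by intro j _; fin_cases j <;> simp <;> positivity)
  simp only [Fin.sum_univ_five, Matrix.cons_val] at cs
  rw [← e, mul_comm] at cs
  refine cs.trans (le_of_eq ?_)
  rw [hE]
  simp only [Fin.sum_univ_three]
  field_simp
  ring

/-- A finite family of entropy Hessians has a smallest eigenvalue; it is positive and bounds all the
quadratic forms from below. -/
lemma exists_isLeast_eigenvalue {ι κ : Type*} [Finite ι] [Finite κ] [Nonempty ι] [Nonempty κ]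
    {W : ι → κ → State} (hW : ∀ k a, g.Admissible (W k a)) :
    ∃ lam : ℝ, IsLeast {e : ℝ | ∃ k a, Module.End.HasEigenvalue
        (Matrix.toLin' (g.entropyHessian (W k a))) e} lam ∧ 0 < lam ∧
      ∀ k a x, lam * (x ⬝ᵥ x) ≤ x ⬝ᵥ (g.entropyHessian (W k a) *ᵥ x) := by
  set Λ := {e : ℝ | ∃ k a, Module.End.HasEigenvalue
        (Matrix.toLin' (g.entropyHessian (W k a))) e} with hΛ
  have hfin : Λ.Finite := by
    have : Λ = ⋃ k, ⋃ a, {e : ℝ | Module.End.HasEigenvalue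
        (Matrix.toLin' (g.entropyHessian (W k a))) e} := by ext; simp [hΛ]
    rw [this]
    exact Set.finite_iUnion fun k => Set.finite_iUnion fun a => Module.End.finite_hasEigenvalue _
  have heig : ∀ {A : Matrix (Fin 5) (Fin 5) ℝ} (hA : A.IsHermitian) (i : Fin 5),
      ∃ v : State, v ≠ 0 ∧ A *ᵥ v = hA.eigenvalues i • v := fun hA i =>
    ⟨_, fun h0 => hA.eigenvectorBasis.orthonormal.ne_zero i (by ext j; exact congrFun h0 j),
      hA.mulVec_eigenvectorBasis i⟩
  have hmem : ∀ {A : Matrix (Fin 5) (Fin 5) ℝ} {v : State} {e : ℝ}, v ≠ 0 → A *ᵥ v = e • v →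
      Module.End.HasEigenvalue (Matrix.toLin' A) e := fun hv he =>
    Module.End.hasEigenvalue_of_hasEigenvector (x := _)
      (Module.End.hasEigenvector_iff.2 ⟨Module.End.mem_eigenspace_iff.2 (by simpa using he), hv⟩)
  have hne : Λ.Nonempty := by
    obtain ⟨k⟩ := ‹Nonempty ι›
    obtain ⟨a⟩ := ‹Nonempty κ›
    obtain ⟨v, hv, he⟩ := heig (hW k a).entropyHessian_isHermitian 0
    exact ⟨_, k, a, hmem hv he⟩
  obtain ⟨lam, hlam, hmin⟩ := Set.exists_min_image Λ id hfin hne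
  refine ⟨lam, ⟨hlam, fun e he => hmin e he⟩, ?_, fun k a x => ?_⟩
  · obtain ⟨k, a, he⟩ := hlam
    obtain ⟨v, hv⟩ := he.exists_hasEigenvector
    have h1 := (hW k a).quadForm_pos hv.2
    have h2 : g.entropyHessian (W k a) *ᵥ v = lam • v := by simpa using hv.apply_eq_smul
    rw [h2, dotProduct_smul, smul_eq_mul] at h1
    have h3 : 0 ≤ v ⬝ᵥ v := dotProduct_self_star_nonneg v
    exact pos_of_mul_pos_left h1 h3
  · have hH := (hW k a).entropyHessian_isHermitian
    have hB : (g.entropyHessian (W k a) - lam • (1 : Matrix (Fin 5) (Fin 5) ℝ)).IsHermitian :=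
      hH.sub (by simp [Matrix.IsHermitian])
    -- every eigenvalue of `H - lam` is an eigenvalue of `H` shifted by `lam`
    have hp := hB.posSemidef_iff_eigenvalues_nonneg.2 fun i => by
      obtain ⟨v, hv, he⟩ := heig hB i
      rw [Matrix.sub_mulVec, Matrix.smul_mulVec, Matrix.one_mulVec, sub_eq_iff_eq_add,
        ← add_smul] at he
      have := hmin _ ⟨k, a, hmem hv he⟩
      simp only [id] at this
      simp only [Pi.zero_apply]
      linarith
    have h := hp.dotProduct_mulVec_nonneg x
    rw [Matrix.sub_mulVec, Matrix.smul_mulVec, Matrix.one_mulVec, dotProduct_sub,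
      dotProduct_smul, star_trivial, smul_eq_mul] at h
    linarith

end Gas

/-! ### Summation by parts on a line -/

/-- Increments summed over the flux points between the solution points `i` and `j`. -/
lemma sum_increments_between {p : ℕ} (f : Fin (p + 1) → ℝ) (i j : Fin (p + 1)) :
    (∑ r : Fin p, if i ≤ r.castSucc ∧ r.castSucc < j then f r.succ - f r.castSucc else 0) =
      if i < j then f j - f i else 0 := by
  induction j using Fin.induction with
  | zero => simp
  | succ m ih =>
    have h : ∀ r : Fin p,
        (if i ≤ r.castSucc ∧ r.castSucc < m.succ then f r.succ - f r.castSucc else 0) =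
        (if i ≤ r.castSucc ∧ r.castSucc < m.castSucc then f r.succ - f r.castSucc else 0) +
        (if r = m then if i ≤ m.castSucc then f m.succ - f m.castSucc else 0 else 0) := by
      intro r
      rcases eq_or_ne r m with rfl | hr
      · simp
      · have : r.castSucc < m.succ ↔ r.castSucc < m.castSucc := by
          rw [Fin.castSucc_lt_succ_iff, Fin.castSucc_lt_castSucc_iff, le_iff_lt_or_eq]
          simp [hr]
        simp [hr, this]
    simp only [h, Finset.sum_add_distrib, ih, Finset.sum_ite_eq', Finset.mem_univ, if_true]
    rcases lt_trichotomy i m.castSucc with h1 | rfl | h1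
    · simp [h1, h1.le, h1.trans (Fin.castSucc_lt_succ)]
    · simp
    · have h2 : ¬ i < m.succ := by
        rw [not_lt]; exact Fin.castSucc_lt_iff_succ_le.1 h1
      simp [h1.not_ge, h1.le.not_gt, h2]

namespace SBP
variable {p : ℕ} (B : SBP p)

lemma sum_D (i : Fin (p + 1)) : ∑ j, B.D i j = 0 := by
  simpa using B.D_exact 1 (by simp) i

lemma sum_Q_row (i : Fin (p + 1)) : ∑ j, B.Q i j = 0 := by
  simp only [Q, ← Finset.mul_sum, B.sum_D, mul_zero]

/-- Summation by parts for a bilinear expression `c i j` in two grid functions. -/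
lemma sum_Q_add_sum_Q (c : Fin (p + 1) → Fin (p + 1) → ℝ) :
    (∑ i, ∑ j, B.Q i j * c i j) + ∑ i, ∑ j, B.Q i j * c j i =
      c (Fin.last p) (Fin.last p) - c 0 0 := by
  rw [Finset.sum_comm (f := fun i j => B.Q i j * c j i), ← Finset.sum_add_distrib]
  simp only [← Finset.sum_add_distrib, ← add_mul, Q, B.sbp, sub_mul, ite_mul, one_mul, zero_mul,
    Finset.sum_sub_distrib, ite_and]
  simp

/-- Off the diagonal `𝒬` is antisymmetric, so for antisymmetric `e` twice the sum over
`i < j` is the sum over all `i`, `j`. -/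
lemma sum_lt_two_Q {e : Fin (p + 1) → Fin (p + 1) → ℝ} (he : ∀ i j, e j i = -e i j) :
    (∑ i, ∑ j, if i < j then 2 * B.Q i j * e i j else 0) = ∑ i, ∑ j, B.Q i j * e i j := by
  have hQ : ∀ i j, i ≠ j → B.Q j i = -B.Q i j := fun i j hij => by
    have h := B.sbp i j
    have h1 : ¬ (i = Fin.last p ∧ j = Fin.last p) := fun h => hij (h.1.trans h.2.symm)
    have h2 : ¬ (i = 0 ∧ j = 0) := fun h => hij (h.1.trans h.2.symm)
    simp only [h1, h2, if_false, sub_zero] at h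
    simp only [Q]; linarith
  have h1 : ∑ i, ∑ j, B.Q i j * e i j =
      (∑ i, ∑ j, if i < j then B.Q i j * e i j else 0) +
        ∑ i, ∑ j, if j < i then B.Q i j * e i j else 0 := by
    rw [← Finset.sum_add_distrib]
    refine Finset.sum_congr rfl fun i _ => ?_
    rw [← Finset.sum_add_distrib]
    refine Finset.sum_congr rfl fun j _ => ?_
    rcases lt_trichotomy i j with h | rfl | h
    · simp [h, h.le.not_gt]
    · have := he i i
      simp; right; linarith
    · simp [h, h.le.not_gt]
  rw [h1, Finset.sum_comm (f := fun i j => if j < i then B.Q i j * e i j else 0),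
    ← Finset.sum_add_distrib]
  refine Finset.sum_congr rfl fun i _ => ?_
  rw [← Finset.sum_add_distrib]
  refine Finset.sum_congr rfl fun j _ => ?_
  split_ifs with h
  · rw [hQ i j h.ne, he i j]; ring
  · simp

/-- Fluxes of the form `∑_{i ≤ r < j} c_{ij} G_{ij}`, contracted with the increments of a grid
function along a line, telescope to a sum over pairs of solution points. -/
lemma sum_increments_pairwise {ι : Type*} [Fintype ι] (f : Fin (p + 1) → ι → ℝ)
    (c : Fin (p + 1) → Fin (p + 1) → ℝ) (G : Fin (p + 1) → Fin (p + 1) → ι → ℝ) :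
    (∑ r : Fin p, ∑ i, ∑ j, if i ≤ r.castSucc ∧ r.castSucc < j then
      c i j * ((f r.succ - f r.castSucc) ⬝ᵥ G i j) else 0) =
      ∑ i, ∑ j, if i < j then c i j * ((f j - f i) ⬝ᵥ G i j) else 0 := by
  rw [Finset.sum_comm]
  refine Finset.sum_congr rfl fun i _ => ?_
  rw [Finset.sum_comm]
  refine Finset.sum_congr rfl fun j _ => ?_
  have := congrArg (c i j * ·) (sum_increments_between (fun r => f r ⬝ᵥ G i j) i j)
  simp only [Finset.mul_sum, mul_ite, mul_zero, ← sub_dotProduct] at this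
  exact this

/-- The entropy conservation identity on a line: pairwise potential differences contracted with
averaged metric terms leave only the boundary values and the derivative of the metric terms. -/
lemma sum_potential {ι : Type*} [Fintype ι] (ψ a : Fin (p + 1) → ι → ℝ) :
    (∑ r : Fin p, ∑ i, ∑ j, if i ≤ r.castSucc ∧ r.castSucc < j then
      2 * B.Q i j * ((ψ r.succ - ψ r.castSucc) ⬝ᵥ ((1 / 2 : ℝ) • (a i + a j))) else 0) =
    ψ (Fin.last p) ⬝ᵥ a (Fin.last p) - ψ 0 ⬝ᵥ a 0 -
      ∑ i, B.P i * (ψ i ⬝ᵥ ∑ j, B.D i j • a j) := by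
  rw [sum_increments_pairwise,
    B.sum_lt_two_Q (e := fun i j => (ψ j - ψ i) ⬝ᵥ ((1 / 2 : ℝ) • (a i + a j)))
    fun i j => by rw [← neg_dotProduct, neg_sub, add_comm (a j)]]
  have h2 : ∀ i j, B.Q i j * ((ψ j - ψ i) ⬝ᵥ ((1 / 2 : ℝ) • (a i + a j))) =
      1 / 2 * (B.Q i j * (ψ j ⬝ᵥ a i) + B.Q i j * (ψ i ⬝ᵥ a j)) - B.Q i j * (ψ i ⬝ᵥ a j) +
        1 / 2 * (B.Q i j * (ψ j ⬝ᵥ a j) + B.Q i j * (ψ i ⬝ᵥ a i)) -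
        B.Q i j * (ψ i ⬝ᵥ a i) := fun i j => by
    simp only [dotProduct_smul, sub_dotProduct, dotProduct_add, smul_eq_mul]; ring
  have e1 := B.sum_Q_add_sum_Q fun i j => ψ i ⬝ᵥ a j
  have e2 := B.sum_Q_add_sum_Q fun i _ => ψ i ⬝ᵥ a i
  have e3 : ∑ i, ∑ j, B.Q i j * (ψ i ⬝ᵥ a i) = 0 := by
    simp only [← Finset.sum_mul, B.sum_Q_row, zero_mul, Finset.sum_const_zero]
  have e4 : ∑ i, ∑ j, B.Q i j * (ψ i ⬝ᵥ a j) = ∑ i, B.P i * (ψ i ⬝ᵥ ∑ j, B.D i j • a j) := by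
    simp only [dotProduct_sum, dotProduct_smul, smul_eq_mul, Finset.mul_sum, Q, mul_assoc]
  simp only [h2, Finset.sum_add_distrib, Finset.sum_sub_distrib, ← Finset.mul_sum]
  linarith

/-- Summation by parts for the collocation derivative. -/
lemma sum_parts {ι : Type*} [Fintype ι] (φ F : Fin (p + 1) → ι → ℝ) :
    ∑ i, B.P i * (φ i ⬝ᵥ ∑ j, B.D i j • F j) =
      φ (Fin.last p) ⬝ᵥ F (Fin.last p) - φ 0 ⬝ᵥ F 0 -
        ∑ i, B.P i * ((∑ j, B.D i j • φ j) ⬝ᵥ F i) := by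
  have e := B.sum_Q_add_sum_Q fun i j => φ i ⬝ᵥ F j
  simp only [dotProduct_sum, dotProduct_smul, sum_dotProduct, smul_dotProduct, smul_eq_mul,
    Finset.mul_sum, ← mul_assoc]
  simp only [Q] at e
  linarith

end SBP

/-! ### Tensor product elements -/

section Nodes
variable {p : ℕ}

@[simp] lemma lineNode_same (l : Fin 3) (b : Tang p) (i : Fin (p + 1)) : lineNode l b i l = i := by
  simp [lineNode]

@[simp] lemma tang_lineNode (l : Fin 3) (b : Tang p) (i : Fin (p + 1)) :
    tang l (lineNode l b i) = b := by
  simp [tang, lineNode]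

lemma sum_nodes {V : Type*} [AddCommMonoid V] (l : Fin 3) (f : Node p → V) :
    ∑ a, f a = ∑ b : Tang p, ∑ i, f (lineNode l b i) := by
  rw [← (Fin.insertNthEquiv (fun _ => Fin (p + 1)) l).sum_comp, Fintype.sum_prod_type_right]
  rfl

namespace SBP
variable (B : SBP p)

lemma weight_pos (a : Node p) : 0 < B.weight a := Finset.prod_pos fun _ _ => B.P_pos _

lemma faceWeight_pos (b : Tang p) : 0 < B.faceWeight b := Finset.prod_pos fun _ _ => B.P_pos _

lemma weight_lineNode (l : Fin 3) (b : Tang p) (i : Fin (p + 1)) :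
    B.weight (lineNode l b i) = B.P i * B.faceWeight b := by
  rw [weight, Fin.prod_univ_succAbove _ l, faceWeight]
  simp [lineNode]

lemma sum_weight (l : Fin 3) (f : Node p → ℝ) :
    ∑ a, B.weight a * f a =
      ∑ b, B.faceWeight b * ∑ i, B.P i * f (lineNode l b i) := by
  rw [sum_nodes l]
  simp only [weight_lineNode, Finset.mul_sum]
  exact Finset.sum_congr rfl fun _ _ => Finset.sum_congr rfl fun _ _ => by ring

@[simp] lemma diff_lineNode {V : Type} [AddCommGroup V] [Module ℝ V] (l : Fin 3) (φ : Node p → V)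
    (b : Tang p) (i : Fin (p + 1)) :
    B.diff l φ (lineNode l b i) = ∑ j, B.D i j • φ (lineNode l b j) := by
  simp [diff]

lemma diff_const {V : Type} [AddCommGroup V] [Module ℝ V] (l : Fin 3) (v : V) (a : Node p) :
    B.diff l (fun _ => v) a = 0 := by
  simp [diff, ← Finset.sum_smul, B.sum_D]

/-- The value of a grid function of one element at the end points of a grid line, summed with
the sign of the outward normal. -/
lemma sum_side {V : Type*} [AddCommGroup V] [Module ℝ V] (f : Fin (p + 1) → V) :
    ∑ side : Bool, sideSign side • f (endIdx side) = f (Fin.last p) - f 0 := by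
  simp [sideSign, endIdx, sub_eq_add_neg]

lemma sum_weight_diff (l : Fin 3) (φ F : Node p → State) :
    ∑ a, B.weight a * (φ a ⬝ᵥ B.diff l F a) =
      (∑ side, ∑ b, B.faceWeight b * (φ (lineNode l b (endIdx side)) ⬝ᵥ
        (sideSign side • F (lineNode l b (endIdx side))))) -
      ∑ a, B.weight a * (B.diff l φ a ⬝ᵥ F a) := by
  rw [B.sum_weight l, B.sum_weight l, Finset.sum_comm, ← Finset.sum_sub_distrib]
  refine Finset.sum_congr rfl fun b _ => ?_
  simp only [diff_lineNode]
  rw [B.sum_parts, ← Finset.mul_sum, ← mul_sub]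
  simp only [dotProduct_smul]
  rw [sum_side fun i => φ (lineNode l b i) ⬝ᵥ F (lineNode l b i)]

lemma sum_weight_penalty {K : ℕ} (G : FacePt K p → State) (k : Fin K) (l : Fin 3)
    (φ : Node p → State) :
    ∑ a, B.weight a * (φ a ⬝ᵥ B.penalty G k l a) =
      ∑ side, ∑ b, B.faceWeight b * (φ (lineNode l b (endIdx side)) ⬝ᵥ G (k, l, side, b)) := by
  rw [B.sum_weight l, Finset.sum_comm]
  refine Finset.sum_congr rfl fun b _ => ?_
  rw [← Finset.mul_sum]
  congr 1
  have h : ∀ i, B.P i * (φ (lineNode l b i) ⬝ᵥ B.penalty G k l (lineNode l b i)) =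
      ∑ side : Bool, if i = endIdx side then φ (lineNode l b i) ⬝ᵥ G (k, l, side, b) else 0 := by
    intro i
    simp only [penalty, lineNode_same, tang_lineNode, dotProduct_smul, smul_eq_mul, dotProduct_sum]
    rw [mul_inv_cancel_left₀ (B.P_pos i).ne']
    exact Finset.sum_congr rfl fun s _ => by split_ifs <;> simp
  simp only [h]
  rw [Finset.sum_comm]
  simp

lemma sum_weight_fluxDiff (l : Fin 3) (F : Tang p → Fin (p + 2) → State) (φ : Node p → State) :
    ∑ a, B.weight a * (φ a ⬝ᵥ B.fluxDiff l F a) =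
      ∑ b, B.faceWeight b * (φ (lineNode l b (Fin.last p)) ⬝ᵥ F b (Fin.last (p + 1)) -
        φ (lineNode l b 0) ⬝ᵥ F b 0 -
        ∑ r : Fin p, (φ (lineNode l b r.succ) - φ (lineNode l b r.castSucc)) ⬝ᵥ
          F b r.succ.castSucc) := by
  rw [B.sum_weight l]
  refine Finset.sum_congr rfl fun b _ => ?_
  congr 1
  have h : ∀ i, B.P i * (φ (lineNode l b i) ⬝ᵥ B.fluxDiff l F (lineNode l b i)) =
      φ (lineNode l b i) ⬝ᵥ F b i.succ - φ (lineNode l b i) ⬝ᵥ F b i.castSucc := by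
    intro i
    simp only [fluxDiff, lineNode_same, tang_lineNode, dotProduct_smul, smul_eq_mul,
      dotProduct_sub]
    rw [mul_inv_cancel_left₀ (B.P_pos i).ne']
  simp only [h, Finset.sum_sub_distrib, sub_dotProduct]
  rw [Fin.sum_univ_castSucc (fun i => φ (lineNode l b i) ⬝ᵥ F b i.succ),
    Fin.sum_univ_succ (fun i => φ (lineNode l b i) ⬝ᵥ F b i.castSucc)]
  simp only [Fin.succ_last, Fin.castSucc_zero, Fin.succ_castSucc]
  ring

end SBP
end Nodes

/-! ### Pairing the scheme with a grid function -/

namespace Gas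

lemma directedFlux_smul (g : Gas) (c : ℝ) (n : Vec3) (u : State) :
    g.directedFlux (c • n) u = c • g.directedFlux n u := by
  simp [directedFlux, Finset.smul_sum, mul_smul]

end Gas

namespace Scheme
variable {K p : ℕ} (X : Scheme K p)

/-- Quadrature over all face points of the grid. -/
def faceSum (h : FacePt K p → ℝ) : ℝ := ∑ f, X.sbp.faceWeight f.2.2.2 * h f

/-- Sum over all interior flux points of the grid, weighted by the tangential quadrature. -/
def innerSum (h : InnerPt K p → ℝ) : ℝ := ∑ q, X.sbp.faceWeight q.2.2.1 * h q

/-- The flux in the outward normal direction at a face point. -/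
def normalFlux (F : Fin K → Node p → Fin 3 → State) (f : FacePt K p) : State :=
  ∑ m, X.mesh.normal f m • f.val F m

/-- The part of a volume term that summation by parts leaves in the interior of the elements. -/
def volumeTerm (φ : Grid K p) (F : Fin K → Node p → Fin 3 → State) : ℝ :=
  X.sum fun k a => ∑ l, X.sbp.diff l (φ k) a ⬝ᵥ ∑ m, X.mesh.metric k l a m • F k a m

lemma faceSum_eq (h : FacePt K p → ℝ) :
    X.faceSum h = ∑ k, ∑ l, ∑ side, ∑ b, X.sbp.faceWeight b * h (k, l, side, b) := by
  simp only [faceSum, Fintype.sum_prod_type]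

lemma innerSum_eq (h : InnerPt K p → ℝ) :
    X.innerSum h = ∑ k, ∑ l, ∑ b, X.sbp.faceWeight b * ∑ r, h (k, l, b, r) := by
  simp only [innerSum, Fintype.sum_prod_type, Finset.mul_sum]

lemma sum_dotProduct_sum (φ : Grid K p) (G : Fin K → Fin 3 → Node p → State) :
    X.sum (fun k a => φ k a ⬝ᵥ ∑ l, G k l a) =
      ∑ k, ∑ l, ∑ a, X.sbp.weight a * (φ k a ⬝ᵥ G k l a) := by
  simp only [Scheme.sum, smul_eq_mul, dotProduct_sum, Finset.mul_sum]
  exact Finset.sum_congr rfl fun k _ => Finset.sum_comm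

lemma faceSum_add (h₁ h₂ : FacePt K p → ℝ) :
    X.faceSum (fun f => h₁ f + h₂ f) = X.faceSum h₁ + X.faceSum h₂ := by
  simp only [faceSum, mul_add, Finset.sum_add_distrib]

lemma faceSum_const_mul (c : ℝ) (h : FacePt K p → ℝ) :
    X.faceSum (fun f => c * h f) = c * X.faceSum h := by
  simp only [faceSum, Finset.mul_sum]
  exact Finset.sum_congr rfl fun _ _ => by ring

lemma innerSum_mono {h₁ h₂ : InnerPt K p → ℝ} (h : ∀ f, h₁ f ≤ h₂ f) :
    X.innerSum h₁ ≤ X.innerSum h₂ :=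
  Finset.sum_le_sum fun f _ => mul_le_mul_of_nonneg_left (h f) (X.sbp.faceWeight_pos _).le

/-- Glued face points carry equal weights. -/
lemma faceSum_nbr (h : FacePt K p → ℝ) :
    X.faceSum (fun f => h (X.mesh.nbr f)) = X.faceSum h := by
  refine Finset.sum_equiv (Function.Involutive.toPerm X.mesh.nbr X.mesh.nbr_nbr) (by simp)
    fun f _ => ?_
  exact congrArg (· * h (X.mesh.nbr f)) (X.mesh.nbr_weight f).symm

/-- Interface fluxes that are antisymmetric under exchange of the two sides only see jumps. -/
lemma faceSum_antisymm {ι : Type} [Fintype ι] (φ : Fin K → Node p → ι → ℝ)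
    {Φ : FacePt K p → ι → ℝ} (hΦ : ∀ f, Φ (X.mesh.nbr f) = -Φ f) :
    X.faceSum (fun f => f.val φ ⬝ᵥ Φ f) =
      X.faceSum (fun f => 1 / 2 * ((f.val φ - (X.mesh.nbr f).val φ) ⬝ᵥ Φ f)) := by
  have h := X.faceSum_nbr fun f => f.val φ ⬝ᵥ Φ f
  have h2 : X.faceSum (fun f => 1 / 2 * ((f.val φ - (X.mesh.nbr f).val φ) ⬝ᵥ Φ f)) =
      1 / 2 * X.faceSum (fun f => f.val φ ⬝ᵥ Φ f) +
      1 / 2 * X.faceSum (fun f => (X.mesh.nbr f).val φ ⬝ᵥ Φ (X.mesh.nbr f)) := by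
    rw [← faceSum_const_mul, ← faceSum_const_mul, ← faceSum_add]
    congr 1; funext f
    rw [hΦ, dotProduct_neg, sub_dotProduct]; ring
  rw [h2, h]; ring

lemma normal_nbr (f : FacePt K p) : X.mesh.normal (X.mesh.nbr f) = -X.mesh.normal f :=
  X.mesh.nbr_normal f

/-- Summation by parts for a semi-discrete operator with inviscid fluxes `H` at interior flux
points, viscous fluxes `F` and interface penalties `N`. -/
lemma sum_dotProduct_operator (φ U : Grid K p) (H : InnerPt K p → State)
    (F : Fin K → Node p → Fin 3 → State) (N : FacePt K p → State) :
    X.sum (fun k a => φ k a ⬝ᵥ ∑ l, (-X.sbp.fluxDiff l (X.withEnds U k l H) a +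
        X.diffFlux F k l a + X.sbp.penalty N k l a)) =
      X.innerSum (fun q => (rightState φ q - leftState φ q) ⬝ᵥ H q) +
      X.faceSum (fun f => f.val φ ⬝ᵥ
        (N f - X.gas.directedFlux (X.mesh.normal f) (f.val U) + X.normalFlux F f)) -
      X.volumeTerm φ F := by
  have hv : X.volumeTerm φ F = ∑ k, ∑ l, ∑ a, X.sbp.weight a *
      (X.sbp.diff l (φ k) a ⬝ᵥ ∑ m, X.mesh.metric k l a m • F k a m) := by
    simp only [volumeTerm, Scheme.sum, smul_eq_mul, Finset.mul_sum]
    exact Finset.sum_congr rfl fun k _ => Finset.sum_comm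
  rw [X.sum_dotProduct_sum, innerSum_eq, faceSum_eq, hv, ← Finset.sum_add_distrib,
    ← Finset.sum_sub_distrib]
  refine Finset.sum_congr rfl fun k _ => ?_
  rw [← Finset.sum_add_distrib, ← Finset.sum_sub_distrib]
  refine Finset.sum_congr rfl fun l _ => ?_
  simp only [dotProduct_add, dotProduct_neg, mul_add, mul_neg, Finset.sum_add_distrib,
    Finset.sum_neg_distrib, dotProduct_sub, mul_sub, Finset.sum_sub_distrib]
  have e1 := X.sbp.sum_weight_fluxDiff l (X.withEnds U k l H) (φ k)
  have e2 := X.sbp.sum_weight_diff l (φ k) (fun a' => ∑ m, X.mesh.metric k l a' m • F k a' m)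
  have e3 := X.sbp.sum_weight_penalty N k l (φ k)
  have e4 : ∀ b : Tang p, φ k (lineNode l b (Fin.last p)) ⬝ᵥ
        X.withEnds U k l H b (Fin.last (p + 1)) -
        φ k (lineNode l b 0) ⬝ᵥ X.withEnds U k l H b 0 =
      ∑ side : Bool, φ k (lineNode l b (endIdx side)) ⬝ᵥ
        X.gas.directedFlux (X.mesh.normal (k, l, side, b)) (U k (lineNode l b (endIdx side))) := by
    intro b
    have e5 : X.withEnds U k l H b (Fin.last (p + 1)) =
        X.gas.directedFlux (X.mesh.metric k l (lineNode l b (Fin.last p)))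
          (U k (lineNode l b (Fin.last p))) := by
      rw [← Fin.succ_last]; simp [withEnds]
    rw [e5]
    simp only [Mesh.normal, FacePt.node, Gas.directedFlux_smul, dotProduct_smul]
    rw [SBP.sum_side (fun i => φ k (lineNode l b i) ⬝ᵥ
      X.gas.directedFlux (X.mesh.metric k l (lineNode l b i)) (U k (lineNode l b i)))]
    simp [withEnds]
  simp only [e4] at e1
  have e6 : ∀ b (r : Fin p), X.withEnds U k l H b r.succ.castSucc = H (k, l, b, r) := by
    intro b r
    rw [← Fin.succ_castSucc]; simp [withEnds]
  simp only [e6, mul_sub, Finset.sum_sub_distrib, Finset.mul_sum _ _ (X.sbp.faceWeight _)] at e1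
  rw [Finset.sum_comm (s := Finset.univ (α := Tang p)) (t := Finset.univ (α := Bool))] at e1
  have e7 : ∀ side b, sideSign side •
      ∑ m, X.mesh.metric k l (lineNode l b (endIdx side)) m • F k (lineNode l b (endIdx side)) m =
      X.normalFlux F (k, l, side, b) := by
    intro side b
    simp [normalFlux, Mesh.normal, FacePt.val, FacePt.node, Finset.smul_sum, mul_smul]
  simp only [e7] at e2
  rw [e1, show (∑ a, X.sbp.weight a * (φ k a ⬝ᵥ X.diffFlux F k l a)) = _ from e2, e3]
  simp only [FacePt.val, FacePt.node, rightState, leftState, Finset.mul_sum]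
  ring

/-- The combined flux of the scheme at an interior flux point. -/
def innerFlux (c : Coeffs X) (U : Grid K p) (q : InnerPt K p) : State :=
  c.θ q.1 • X.highFlux U q + (1 - c.θ q.1) • X.lowFlux U q -
    ((1 - c.θ q.1) • X.brennerLow c.mass U q + X.brennerLow c.ad U q)

/-- The sum of the viscous and the high-order artificial dissipation flux. -/
def gradFlux (c : Coeffs X) (U : Grid K p) (k : Fin K) (a : Node p) : Fin 3 → State :=
  fun m => X.viscFlux U k a m + X.adFlux c U k a m

/-- The sum of all interface penalties. -/
def totalPenalty (c : Coeffs X) (U : Grid K p) (f : FacePt K p) : State :=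
  X.nsPenalty c U f + (X.brennerFace c.adFace U f +
    (X.centeredPenalty (X.adFlux c U) f + X.brennerFace c.ipAD U f))

lemma withEnds_innerFlux (c : Coeffs X) (U : Grid K p) (k : Fin K) (l : Fin 3) (b : Tang p)
    (i : Fin (p + 2)) :
    X.withEnds U k l (X.innerFlux c U) b i =
      c.θ k • X.withEnds U k l (X.highFlux U) b i +
        (1 - c.θ k) • X.withEnds U k l (X.lowFlux U) b i -
        innerOnly k l (fun q => (1 - c.θ k) • X.brennerLow c.mass U q + X.brennerLow c.ad U q) b i := by
  refine Fin.cases ?_ (fun j => ?_) i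
  · simp [withEnds, innerOnly, ← add_smul]
  · refine Fin.lastCases ?_ (fun r => ?_) j
    · simp [withEnds, innerOnly, ← add_smul]
    · simp [withEnds, innerOnly, innerFlux]

lemma diff_add_fun (l : Fin 3) (φ ψ : Node p → State) (a : Node p) :
    X.sbp.diff l (fun a => φ a + ψ a) a = X.sbp.diff l φ a + X.sbp.diff l ψ a := by
  simp [SBP.diff, Finset.sum_add_distrib]

lemma penalty_add (N₁ N₂ : FacePt K p → State) (k : Fin K) (l : Fin 3) (a : Node p) :
    X.sbp.penalty (fun f => N₁ f + N₂ f) k l a =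
      X.sbp.penalty N₁ k l a + X.sbp.penalty N₂ k l a := by
  simp only [SBP.penalty, ← smul_add, ← Finset.sum_add_distrib]
  congr 2; funext s; split_ifs <;> simp

/-- Since the limiter is constant on an element and the blended fluxes agree at the ends of each
line, the scheme has a single flux at each flux point and a single penalty on each face. -/
lemma rhs_eq (c : Coeffs X) (U : Grid K p) (k : Fin K) (a : Node p) :
    X.rhs c U k a = ∑ l, (-X.sbp.fluxDiff l (X.withEnds U k l (X.innerFlux c U)) a +
      X.diffFlux (X.gradFlux c U) k l a + X.sbp.penalty (X.totalPenalty c U) k l a) := by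
  simp only [rhs, rhsHigh, rhsLow, rhsAD, Finset.smul_sum, ← Finset.sum_add_distrib]
  refine Finset.sum_congr rfl fun l _ => ?_
  have h1 : X.sbp.fluxDiff l (X.withEnds U k l (X.innerFlux c U)) a =
      c.θ k • X.sbp.fluxDiff l (X.withEnds U k l (X.highFlux U)) a +
      (1 - c.θ k) • X.sbp.fluxDiff l (X.withEnds U k l (X.lowFlux U)) a -
      X.sbp.fluxDiff l (innerOnly k l
        (fun q => (1 - c.θ k) • X.brennerLow c.mass U q + X.brennerLow c.ad U q)) a := by
    simp only [SBP.fluxDiff, withEnds_innerFlux]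
    module
  have h2 : X.diffFlux (X.gradFlux c U) k l a =
      X.diffFlux (X.viscFlux U) k l a + X.diffFlux (X.adFlux c U) k l a := by
    simp only [diffFlux, gradFlux, smul_add, Finset.sum_add_distrib, diff_add_fun]
  have h3 := X.penalty_add (X.nsPenalty c U) (fun f => X.brennerFace c.adFace U f +
    (X.centeredPenalty (X.adFlux c U) f + X.brennerFace c.ipAD U f)) k l a
  rw [h1, h2, show X.sbp.penalty (X.totalPenalty c U) k l a = _ from h3]
  module

/-- The total numerical flux across an interface, with the sign of what enters the element. -/
def faceFlux (c : Coeffs X) (U : Grid K p) (f : FacePt K p) : State :=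
  -X.merriamRoeFlux (X.mesh.normal f) (f.val U) ((X.mesh.nbr f).val U) +
    (1 / 2 : ℝ) • (X.normalFlux (X.gradFlux c U) f -
      X.normalFlux (X.gradFlux c U) (X.mesh.nbr f)) +
    (X.brennerFace c.ipVisc U f + X.brennerFace c.adFace U f + X.brennerFace c.ipAD U f)

/-- The boundary terms left by summation by parts turn the penalties into a numerical flux. -/
lemma totalPenalty_eq (c : Coeffs X) (U : Grid K p) (f : FacePt K p) :
    X.totalPenalty c U f - X.gas.directedFlux (X.mesh.normal f) (f.val U) +
      X.normalFlux (X.gradFlux c U) f = X.faceFlux c U f := by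
  have h : ∀ f, X.normalFlux (X.gradFlux c U) f =
      X.normalFlux (X.viscFlux U) f + X.normalFlux (X.adFlux c U) f := fun f => by
    simp only [normalFlux, FacePt.val, gradFlux, smul_add, Finset.sum_add_distrib]
  simp only [totalPenalty, nsPenalty, inviscidPenalty, centeredPenalty, faceFlux, h]
  simp only [normalFlux]
  module

lemma sum_dotProduct_rhs (c : Coeffs X) (U φ : Grid K p) :
    X.sum (fun k a => φ k a ⬝ᵥ X.rhs c U k a) =
      X.innerSum (fun q => (rightState φ q - leftState φ q) ⬝ᵥ X.innerFlux c U q) +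
      X.faceSum (fun f => f.val φ ⬝ᵥ X.faceFlux c U f) -
      X.volumeTerm φ (X.gradFlux c U) := by
  simp only [rhs_eq, X.sum_dotProduct_operator, totalPenalty_eq]

end Scheme

/-! ### Antisymmetry of the interface fluxes and conservation -/

namespace Gas

/-- Reversing the direction negates the eigenvalues and keeps their absolute values. -/
lemma isMerriamRoe_neg (g : Gas) (n : Vec3) (u : State) (M : Matrix (Fin 5) (Fin 5) ℝ) :
    g.IsMerriamRoe (-n) u M ↔ g.IsMerriamRoe n u M := by
  have hJ : ∀ n : Vec3, g.fluxJacobian (-n) u = -g.fluxJacobian n u := fun n => by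
    ext i j
    have : (fun v => g.directedFlux (-n) v i) = fun v => -g.directedFlux n v i := by
      funext v
      rw [← neg_one_smul ℝ n, directedFlux_smul]; simp
    simp only [fluxJacobian, Matrix.of_apply, Matrix.neg_apply, this, fderiv_fun_neg]
    rfl
  have key : ∀ n : Vec3, g.IsMerriamRoe n u M → g.IsMerriamRoe (-n) u M := by
    rintro n ⟨Y, ev, h1, h2, h3⟩
    refine ⟨Y, fun i => -ev i, ?_, h2, ?_⟩
    · rw [hJ, Matrix.neg_mul, h1, ← Matrix.mul_neg, Matrix.diagonal_neg]
    · simpa only [abs_neg] using h3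
  exact ⟨fun h => by simpa using key _ h, key n⟩

lemma merriamRoe_neg (g : Gas) (n : Vec3) (u : State) :
    g.merriamRoe (-n) u = g.merriamRoe n u := by
  have : g.IsMerriamRoe (-n) u = g.IsMerriamRoe n u :=
    funext fun M => propext (g.isMerriamRoe_neg n u M)
  unfold merriamRoe
  rw [this]

/-- If no decomposition exists, the dissipation matrix is zero by definition and the bound is
trivial. -/
lemma merriamRoe_nonneg (g : Gas) (n : Vec3) (u x : State) :
    0 ≤ x ⬝ᵥ (g.merriamRoe n u *ᵥ x) := by
  rw [merriamRoe]
  split_ifs with h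
  · obtain ⟨Y, ev, -, -, h3⟩ := h.choose_spec
    rw [h3, ← Matrix.mulVec_mulVec, ← Matrix.mulVec_mulVec, Matrix.dotProduct_mulVec,
      ← Matrix.mulVec_transpose]
    simp only [dotProduct, Matrix.mulVec_diagonal]
    refine Finset.sum_nonneg fun i _ => ?_
    nlinarith [mul_nonneg (abs_nonneg (ev i)) (mul_self_nonneg ((Yᵀ *ᵥ x) i))]
  · simp

end Gas

namespace Scheme
variable {K p : ℕ} (X : Scheme K p)

lemma merriamRoeFlux_neg (n : Vec3) {u v : State} (hu : X.gas.Admissible u)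
    (hv : X.gas.Admissible v) :
    X.merriamRoeFlux (-n) v u = -X.merriamRoeFlux n u v := by
  have h1 : X.ec.directed (-n) v u = -X.ec.directed n u v := by
    simp only [ECFlux.directed, X.ec.symm v u hv hu, Pi.neg_apply, neg_smul,
      Finset.sum_neg_distrib]
  rw [merriamRoeFlux, merriamRoeFlux, h1, Gas.merriamRoe_neg, (X.avg.symm v u hv hu).1,
    ← neg_sub (X.gas.entropyVar v), Matrix.mulVec_neg]
  module

lemma brennerTwoPoint_neg {g : Gas} (A : Averages g) (c : BrennerCoeff) (n : Vec3) {u v : State}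
    (hu : g.Admissible u) (hv : g.Admissible v) :
    brennerTwoPoint A c (-n) v u = -brennerTwoPoint A c n u v := by
  obtain ⟨-, h1, h2, h3, h4⟩ := A.symm v u hv hu
  have h5 : (fun j => (-n j / c.h) • (g.entropyVar u - g.entropyVar v)) =
      fun j => (n j / c.h) • (g.entropyVar v - g.entropyVar u) := by
    funext j
    rw [neg_div, neg_smul, ← smul_neg, neg_sub]
  simp only [brennerTwoPoint, h1, h2, h3, h4, Pi.neg_apply, h5, neg_smul, Finset.sum_neg_distrib]

lemma brennerFace_nbr {c : FacePt K p → BrennerCoeff} (hc : ∀ f, c (X.mesh.nbr f) = c f)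
    {U : Grid K p} (hU : ∀ k a, X.gas.Admissible (U k a)) (f : FacePt K p) :
    X.brennerFace c U (X.mesh.nbr f) = -X.brennerFace c U f := by
  simp only [brennerFace, hc, X.mesh.nbr_nbr, normal_nbr]
  exact brennerTwoPoint_neg _ _ _ (hU _ _) (hU _ _)

lemma faceFlux_nbr (c : Coeffs X) {U : Grid K p} (hU : ∀ k a, X.gas.Admissible (U k a))
    (f : FacePt K p) : X.faceFlux c U (X.mesh.nbr f) = -X.faceFlux c U f := by
  simp only [faceFlux, X.brennerFace_nbr c.ipVisc_nbr hU, X.brennerFace_nbr c.adFace_nbr hU,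
    X.brennerFace_nbr c.ipAD_nbr hU, X.mesh.nbr_nbr, normal_nbr]
  rw [X.merriamRoeFlux_neg (u := f.val U) (v := (X.mesh.nbr f).val U) _ (hU _ _) (hU _ _)]
  module

/-- Conservation, tested with a constant vector. -/
lemma sum_const_dotProduct_rhs (c : Coeffs X) {U : Grid K p}
    (hU : ∀ k a, X.gas.Admissible (U k a)) (v : State) :
    X.sum (fun k a => v ⬝ᵥ X.rhs c U k a) = 0 := by
  have h := X.sum_dotProduct_rhs c U fun _ _ => v
  rw [X.faceSum_antisymm _ (X.faceFlux_nbr c hU)] at h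
  rw [h]
  simp [innerSum, faceSum, volumeTerm, rightState, leftState, FacePt.val, SBP.diff_const,
    Scheme.sum]

lemma sum_rhs (c : Coeffs X) {U : Grid K p} (hU : ∀ k a, X.gas.Admissible (U k a)) :
    X.sum (X.rhs c U) = 0 := by
  funext i
  have h := X.sum_const_dotProduct_rhs c hU (Pi.single i 1)
  simpa [Scheme.sum, Finset.sum_apply] using h

end Scheme

/-! ### Entropy dissipation -/

/-- The viscous stress dissipates: the deviatoric part of a matrix is orthogonal to the identity. -/
lemma stress_nonneg {μ : ℝ} (hμ : 0 ≤ μ) (G : Fin 3 → Fin 3 → ℝ) :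
    0 ≤ ∑ m, ∑ i, stress μ G i m * G i m := by
  have h : ∑ m, ∑ i, stress μ G i m * G i m = μ *
      ((G 0 1 + G 1 0) ^ 2 + (G 0 2 + G 2 0) ^ 2 + (G 1 2 + G 2 1) ^ 2 +
        2 / 3 * ((G 0 0 - G 1 1) ^ 2 + (G 0 0 - G 2 2) ^ 2 + (G 1 1 - G 2 2) ^ 2)) := by
    simp [stress, Fin.sum_univ_three]
    ring
  rw [h]
  positivity

/-- The Brenner flux, as a linear function of the gradient of the entropy variables, is positive
semidefinite: the quadratic form is a sum of the dissipations by stress, heat conduction and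
mass diffusion. -/
lemma brennerFluxW_nonneg (g : Gas) {ρ T μ κ σ : ℝ} (V : Vec3) (E : ℝ) (hρ : 0 < ρ) (hT : 0 < T)
    (hμ : 0 ≤ μ) (hκ : 0 ≤ κ) (hσ : 0 ≤ σ) (Θ : Fin 3 → State) :
    0 ≤ ∑ m, Θ m ⬝ᵥ brennerFluxW g ρ V T E μ κ σ Θ m := by
  have h : ∑ m, Θ m ⬝ᵥ brennerFluxW g ρ V T E μ κ σ Θ m =
      T⁻¹ * (∑ m, ∑ i, stress μ (fun i j => T * (Θ j (momIdx i) + V i * Θ j 4)) i m *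
        (T * (Θ m (momIdx i) + V i * Θ m 4))) +
      ∑ m, (κ * T ^ 2 * Θ m 4 ^ 2 +
        σ * (ρ / g.R) * (Θ m 0 + ∑ i, V i * Θ m (momIdx i) + E * Θ m 4) ^ 2) := by
    have e0 : momIdx 0 = 1 := rfl
    have e1 : momIdx 1 = 2 := rfl
    have e2 : momIdx 2 = 3 := rfl
    have hT' := hT.ne'
    simp only [Finset.mul_sum, ← Finset.sum_add_distrib]
    refine Finset.sum_congr rfl fun m _ => ?_
    have e3 : ∀ a b : ℝ, T⁻¹ * (a * (T * b)) = a * b := fun a b => by field_simp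
    simp only [e3, brennerFluxW, brennerFlux]
    generalize stress μ (fun i j => T * (Θ j (momIdx i) + V i * Θ j 4)) = τ
    simp only [dotProduct, Fin.sum_univ_five, Fin.sum_univ_three, e0, e1, e2, Matrix.cons_val]
    ring
  have h2 := stress_nonneg hμ fun i j => T * (Θ j (momIdx i) + V i * Θ j 4)
  have hR := g.R_pos
  rw [h]
  positivity

/-- The two-point flux is the Brenner flux of the gradient `n Δw / h`, so `Δw` contracted with it
is `h` times the dissipation of that gradient. -/
lemma brennerTwoPoint_nonneg {g : Gas} (A : Averages g) (c : BrennerCoeff) (n : Vec3)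
    {u v : State} (hu : g.Admissible u) (hv : g.Admissible v) :
    0 ≤ (g.entropyVar v - g.entropyVar u) ⬝ᵥ brennerTwoPoint A c n u v := by
  have h := brennerFluxW_nonneg g (A.vel u v) (A.energy u v) (A.rho_pos u v hu hv)
    (A.temp_pos u v hu hv) c.μ_nonneg c.κ_nonneg c.σ_nonneg
    fun j => (n j / c.h) • (g.entropyVar v - g.entropyVar u)
  have hh := c.h_pos
  have e : (g.entropyVar v - g.entropyVar u) ⬝ᵥ brennerTwoPoint A c n u v =
      c.h * ∑ m, ((n m / c.h) • (g.entropyVar v - g.entropyVar u)) ⬝ᵥ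
        brennerFluxW g (A.rho u v) (A.vel u v) (A.temp u v) (A.energy u v) c.μ c.κ c.σ
          (fun j => (n j / c.h) • (g.entropyVar v - g.entropyVar u)) m := by
    rw [brennerTwoPoint, dotProduct_sum, Finset.mul_sum]
    refine Finset.sum_congr rfl fun m _ => ?_
    rw [dotProduct_smul, smul_dotProduct, smul_eq_mul, smul_eq_mul, ← mul_assoc,
      mul_div_cancel₀ _ hh.ne']
  rw [e]
  exact mul_nonneg hh.le h

namespace ECFlux
variable {g : Gas}

lemma directed_conservative (F : ECFlux g) (n : Vec3) {u v : State} (hu : g.Admissible u)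
    (hv : g.Admissible v) :
    (g.entropyVar v - g.entropyVar u) ⬝ᵥ F.directed n u v =
      (g.entropyPotential v - g.entropyPotential u) ⬝ᵥ n := by
  have h : ∀ m, (g.entropyVar v - g.entropyVar u) ⬝ᵥ F.flux u v m =
      g.entropyPotential v m - g.entropyPotential u m := fun m => by
    rw [F.symm u v hu hv, F.conservative v u hv hu]
  simp only [directed, dotProduct_sum, dotProduct_smul, h, smul_eq_mul]
  exact Finset.sum_congr rfl fun m _ => mul_comm _ _

end ECFlux

namespace Scheme
variable {K p : ℕ} (X : Scheme K p)

/-- Across a flux point the first-order flux produces at most the entropy of the conservative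
one. -/
lemma merriamRoeFlux_le (n : Vec3) {u v : State} (hu : X.gas.Admissible u)
    (hv : X.gas.Admissible v) :
    (X.gas.entropyVar v - X.gas.entropyVar u) ⬝ᵥ X.merriamRoeFlux n u v ≤
      (X.gas.entropyPotential v - X.gas.entropyPotential u) ⬝ᵥ n := by
  rw [merriamRoeFlux, dotProduct_sub, X.ec.directed_conservative n hu hv, dotProduct_smul,
    smul_eq_mul]
  have := X.gas.merriamRoe_nonneg n (X.avg.roe u v) (X.gas.entropyVar v - X.gas.entropyVar u)
  linarith

/-- The potential flux at the solution points. -/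
def potential (U : Grid K p) : Fin K → Node p → Vec3 := fun k a => X.gas.entropyPotential (U k a)

/-- The increment of the potential flux across an interior flux point, contracted with the metric
terms there. -/
def potentialJump (U : Grid K p) (q : InnerPt K p) : ℝ :=
  (X.gas.entropyPotential (rightState U q) - X.gas.entropyPotential (leftState U q)) ⬝ᵥ
    X.fluxPtMetric q

variable {X} {U : Grid K p}

lemma lowFlux_le (hU : ∀ k a, X.gas.Admissible (U k a)) (q : InnerPt K p) :
    (rightState (X.w U) q - leftState (X.w U) q) ⬝ᵥ X.lowFlux U q ≤ X.potentialJump U q :=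
  X.merriamRoeFlux_le _ (hU _ _) (hU _ _)

lemma sum_potentialJump_line (U : Grid K p) (k : Fin K) (l : Fin 3) (b : Tang p) :
    ∑ r, X.potentialJump U (k, l, b, r) =
      ∑ r : Fin p, ∑ i, ∑ j, if i ≤ r.castSucc ∧ r.castSucc < j then 2 * X.sbp.Q i j *
        ((X.potential U k (lineNode l b r.succ) - X.potential U k (lineNode l b r.castSucc)) ⬝ᵥ
          ((1 / 2 : ℝ) • (X.mesh.metric k l (lineNode l b i) +
            X.mesh.metric k l (lineNode l b j)))) else 0 := by
  refine Finset.sum_congr rfl fun r _ => ?_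
  simp only [potentialJump, fluxPtMetric, dotProduct_sum]
  refine Finset.sum_congr rfl fun i _ => Finset.sum_congr rfl fun j _ => ?_
  split_ifs
  · rw [dotProduct_smul, smul_eq_mul]; rfl
  · simp

/-- Along each grid line, the high-order flux produces the same entropy as the potential. -/
lemma sum_highFlux_line (hU : ∀ k a, X.gas.Admissible (U k a)) (k : Fin K) (l : Fin 3)
    (b : Tang p) :
    ∑ r, (rightState (X.w U) (k, l, b, r) - leftState (X.w U) (k, l, b, r)) ⬝ᵥ
      X.highFlux U (k, l, b, r) = ∑ r, X.potentialJump U (k, l, b, r) := by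
  rw [sum_potentialJump_line, SBP.sum_increments_pairwise (fun i => X.potential U k (lineNode l b i))
    (fun i j => 2 * X.sbp.Q i j) (fun i j => (1 / 2 : ℝ) • (X.mesh.metric k l (lineNode l b i) +
            X.mesh.metric k l (lineNode l b j)))]
  have h := SBP.sum_increments_pairwise (fun i => X.w U k (lineNode l b i))
    (fun i j => 2 * X.sbp.Q i j) (fun i j => X.ec.directed
      ((1 / 2 : ℝ) • (X.mesh.metric k l (lineNode l b i) + X.mesh.metric k l (lineNode l b j)))
      (U k (lineNode l b i)) (U k (lineNode l b j)))
  calc _ = _ := ?_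
    _ = _ := h
    _ = _ := ?_
  · refine Finset.sum_congr rfl fun r _ => ?_
    simp only [highFlux, dotProduct_sum]
    refine Finset.sum_congr rfl fun i _ => Finset.sum_congr rfl fun j _ => ?_
    split_ifs
    · rw [dotProduct_smul, smul_eq_mul]; rfl
    · simp
  · refine Finset.sum_congr rfl fun i _ => Finset.sum_congr rfl fun j _ => ?_
    simp only [w, potential]
    rw [X.ec.directed_conservative _ (hU _ _) (hU _ _)]

/-- By the geometric conservation law, the potential increments reduce to interface values. -/
lemma innerSum_potentialJump (U : Grid K p) :
    X.innerSum (X.potentialJump U) =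
      X.faceSum fun f => f.val (X.potential U) ⬝ᵥ X.mesh.normal f := by
  have h : ∀ k l, ∑ b, X.sbp.faceWeight b * ∑ r, X.potentialJump U (k, l, b, r) =
      (∑ side, ∑ b, X.sbp.faceWeight b *
        (X.potential U k (lineNode l b (endIdx side)) ⬝ᵥ X.mesh.normal (k, l, side, b))) -
      ∑ a, X.sbp.weight a * (X.potential U k a ⬝ᵥ X.sbp.diff l (X.mesh.metric k l) a) := by
    intro k l
    rw [X.sbp.sum_weight l, Finset.sum_comm, ← Finset.sum_sub_distrib]
    refine Finset.sum_congr rfl fun b _ => ?_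
    rw [sum_potentialJump_line, X.sbp.sum_potential (fun i => X.potential U k (lineNode l b i))
      (fun i => X.mesh.metric k l (lineNode l b i)), ← Finset.mul_sum, ← mul_sub]
    simp only [SBP.diff_lineNode, Mesh.normal, FacePt.node, dotProduct_smul]
    rw [SBP.sum_side fun i => X.potential U k (lineNode l b i) ⬝ᵥ
      X.mesh.metric k l (lineNode l b i)]
  rw [innerSum_eq, faceSum_eq]
  refine Finset.sum_congr rfl fun k _ => ?_
  simp only [h, Finset.sum_sub_distrib]
  rw [Finset.sum_comm (s := Finset.univ (α := Fin 3)) (t := Finset.univ (α := Node p))]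
  simp only [← Finset.mul_sum, ← dotProduct_sum, X.mesh.gcl, dotProduct_zero, mul_zero,
    Finset.sum_const_zero, sub_zero]
  rfl

lemma innerSum_innerFlux_le (c : Coeffs X) (hU : ∀ k a, X.gas.Admissible (U k a)) :
    X.innerSum (fun q => (rightState (X.w U) q - leftState (X.w U) q) ⬝ᵥ X.innerFlux c U q) ≤
      X.faceSum fun f => f.val (X.potential U) ⬝ᵥ X.mesh.normal f := by
  rw [← innerSum_potentialJump]
  have h1 : ∀ q, (rightState (X.w U) q - leftState (X.w U) q) ⬝ᵥ X.innerFlux c U q ≤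
      c.θ q.1 * ((rightState (X.w U) q - leftState (X.w U) q) ⬝ᵥ X.highFlux U q) +
        (1 - c.θ q.1) * X.potentialJump U q := by
    intro q
    obtain ⟨h0, h1⟩ := c.θ_mem q.1
    have hm : 0 ≤ (rightState (X.w U) q - leftState (X.w U) q) ⬝ᵥ X.brennerLow c.mass U q :=
      brennerTwoPoint_nonneg _ _ _ (hU _ _) (hU _ _)
    have ha : 0 ≤ (rightState (X.w U) q - leftState (X.w U) q) ⬝ᵥ X.brennerLow c.ad U q :=
      brennerTwoPoint_nonneg _ _ _ (hU _ _) (hU _ _)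
    have hl := mul_le_mul_of_nonneg_left (lowFlux_le hU q) (sub_nonneg.2 h1)
    have hm' := mul_nonneg (sub_nonneg.2 h1) hm
    simp only [innerFlux, dotProduct_sub (rightState (X.w U) q - leftState (X.w U) q),
      dotProduct_add, dotProduct_smul, smul_eq_mul]
    linarith
  refine (X.innerSum_mono h1).trans (le_of_eq ?_)
  rw [innerSum_eq, innerSum_eq]
  refine Finset.sum_congr rfl fun k _ => Finset.sum_congr rfl fun l _ =>
    Finset.sum_congr rfl fun b _ => ?_
  simp only [Finset.sum_add_distrib, ← Finset.mul_sum]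
  rw [sum_highFlux_line hU]
  ring

/-- The discrete gradient is dual to the divergence: the volume term and the centered interface
fluxes add up to the pairing of the flux with the gradient. -/
lemma volumeTerm_add_faceSum (U : Grid K p) (F : Fin K → Node p → Fin 3 → State) :
    X.volumeTerm (X.w U) F + X.faceSum (fun f => 1 / 2 *
        (((X.mesh.nbr f).val (X.w U) - f.val (X.w U)) ⬝ᵥ X.normalFlux F f)) =
      X.integral fun k a => ∑ j, X.gradW U k a j ⬝ᵥ F k a j := by
  have h1 : ∀ k a, X.mesh.J k a * ∑ j, X.gradW U k a j ⬝ᵥ F k a j =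
      (∑ l, X.sbp.diff l (X.w U k) a ⬝ᵥ ∑ m, X.mesh.metric k l a m • F k a m) +
      ∑ l, (∑ m, X.mesh.metric k l a m • F k a m) ⬝ᵥ X.sbp.penalty (X.gradPenalty U) k l a := by
    intro k a
    have hJ := (X.mesh.J_pos k a).ne'
    simp only [gradW, sum_dotProduct, smul_dotProduct, add_dotProduct, smul_eq_mul,
      dotProduct_sum, dotProduct_smul, Finset.mul_sum]
    rw [Finset.sum_comm, ← Finset.sum_add_distrib]
    refine Finset.sum_congr rfl fun l _ => ?_
    rw [← Finset.sum_add_distrib]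
    refine Finset.sum_congr rfl fun m _ => ?_
    rw [dotProduct_comm (F k a m)]
    field_simp
  rw [integral, volumeTerm, faceSum_eq]
  simp only [Scheme.sum, h1, smul_eq_mul, mul_add, Finset.sum_add_distrib]
  congr 1
  refine Finset.sum_congr rfl fun k _ => ?_
  simp only [Finset.mul_sum]
  symm
  rw [Finset.sum_comm]
  refine Finset.sum_congr rfl fun l _ => ?_
  rw [X.sbp.sum_weight_penalty (X.gradPenalty U) k l
    (fun a => ∑ m, X.mesh.metric k l a m • F k a m)]
  refine Finset.sum_congr rfl fun side _ => Finset.sum_congr rfl fun b _ => ?_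
  have e : X.normalFlux F (k, l, side, b) = sideSign side • ∑ m,
      X.mesh.metric k l (lineNode l b (endIdx side)) m • F k (lineNode l b (endIdx side)) m := by
    simp [normalFlux, Mesh.normal, FacePt.val, FacePt.node, Finset.smul_sum, mul_smul]
  rw [e, gradPenalty, dotProduct_comm, smul_dotProduct, dotProduct_smul, smul_eq_mul, smul_eq_mul]
  ring

lemma gradFlux_nonneg (c : Coeffs X) (hU : ∀ k a, X.gas.Admissible (U k a)) (k : Fin K)
    (a : Node p) : 0 ≤ ∑ j, X.gradW U k a j ⬝ᵥ X.gradFlux c U k a j := by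
  have hd := (hU k a).density_pos
  have hT := (hU k a).temperature_pos
  have hμ := c.μAD_nonneg k a
  have h1 := brennerFluxW_nonneg X.gas (velocity (U k a)) (specificEnergy (U k a)) hd hT
    (X.gas.visc_nonneg _ hT) (X.gas.cond_nonneg _ hT) le_rfl (X.gradW U k a)
  have h2 := brennerFluxW_nonneg X.gas (velocity (U k a)) (specificEnergy (U k a)) hd hT hμ
    (mul_nonneg X.cT_pos.le hμ) (div_nonneg (mul_nonneg X.cρ_pos.le hμ) hd.le) (X.gradW U k a)
  simp only [gradFlux, dotProduct_add, Finset.sum_add_distrib]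
  exact add_nonneg h1 h2

lemma integral_nonneg {φ : Fin K → Node p → ℝ} (h : ∀ k a, 0 ≤ φ k a) : 0 ≤ X.integral φ := by
  simp only [integral, Scheme.sum, smul_eq_mul]
  exact Finset.sum_nonneg fun k _ => Finset.sum_nonneg fun a _ =>
    mul_nonneg (X.sbp.weight_pos a).le (mul_nonneg (X.mesh.J_pos k a).le (h k a))

/-- The entropy produced by the inviscid interior fluxes is at most the potential at the interfaces,
which the Merriam-Roe interface flux absorbs; the viscous terms dissipate in the volume. -/
lemma dissipation_nonneg (c : Coeffs X) (hU : ∀ k a, X.gas.Admissible (U k a)) :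
    0 ≤ X.dissipation c U := by
  rw [dissipation, X.sum_dotProduct_rhs, X.faceSum_antisymm _ (X.faceFlux_nbr c hU)]
  have h1 := innerSum_innerFlux_le c hU
  have h2 := volumeTerm_add_faceSum (X := X) U (X.gradFlux c U)
  have h3 : 0 ≤ X.integral fun k a => ∑ j, X.gradW U k a j ⬝ᵥ X.gradFlux c U k a j :=
    integral_nonneg fun k a => gradFlux_nonneg c hU k a
  have h4 := X.faceSum_antisymm (X.potential U) (Φ := X.mesh.normal) X.normal_nbr
  -- the centered interface fluxes only see the jump of the entropy variables
  have h5 : X.faceSum (fun f => 1 / 2 *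
        (((X.mesh.nbr f).val (X.w U) - f.val (X.w U)) ⬝ᵥ X.normalFlux (X.gradFlux c U) f)) =
      X.faceSum (fun f => 1 / 4 * (((X.mesh.nbr f).val (X.w U) - f.val (X.w U)) ⬝ᵥ
        (X.normalFlux (X.gradFlux c U) f - X.normalFlux (X.gradFlux c U) (X.mesh.nbr f)))) := by
    have e := X.faceSum_nbr fun f => 1 / 4 *
        (((X.mesh.nbr f).val (X.w U) - f.val (X.w U)) ⬝ᵥ X.normalFlux (X.gradFlux c U) f)
    have e2 : ∀ f, 1 / 4 * (((X.mesh.nbr f).val (X.w U) - f.val (X.w U)) ⬝ᵥ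
        (X.normalFlux (X.gradFlux c U) f - X.normalFlux (X.gradFlux c U) (X.mesh.nbr f))) =
        1 / 4 * (((X.mesh.nbr f).val (X.w U) - f.val (X.w U)) ⬝ᵥ
          X.normalFlux (X.gradFlux c U) f) +
        1 / 4 * (((X.mesh.nbr (X.mesh.nbr f)).val (X.w U) - (X.mesh.nbr f).val (X.w U)) ⬝ᵥ
          X.normalFlux (X.gradFlux c U) (X.mesh.nbr f)) := fun f => by
      rw [X.mesh.nbr_nbr, dotProduct_sub, ← neg_sub ((X.mesh.nbr f).val (X.w U)) (f.val (X.w U)),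
        neg_dotProduct]
      ring
    simp only [e2]
    rw [faceSum_add, e, ← faceSum_add]
    congr 1; funext f; ring
  have h6 : X.faceSum (fun f => 1 / 2 *
        ((f.val (X.w U) - (X.mesh.nbr f).val (X.w U)) ⬝ᵥ X.faceFlux c U f)) +
      X.faceSum (fun f => 1 / 2 *
        ((f.val (X.potential U) - (X.mesh.nbr f).val (X.potential U)) ⬝ᵥ X.mesh.normal f)) +
      X.faceSum (fun f => 1 / 4 * (((X.mesh.nbr f).val (X.w U) - f.val (X.w U)) ⬝ᵥ
        (X.normalFlux (X.gradFlux c U) f - X.normalFlux (X.gradFlux c U) (X.mesh.nbr f)))) ≤ 0 := by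
    rw [← faceSum_add, ← faceSum_add]
    refine Finset.sum_nonpos fun f _ => mul_nonpos_of_nonneg_of_nonpos
      (X.sbp.faceWeight_pos _).le ?_
    have hM : ((X.mesh.nbr f).val (X.w U) - f.val (X.w U)) ⬝ᵥ
        X.merriamRoeFlux (X.mesh.normal f) (f.val U) ((X.mesh.nbr f).val U) ≤
        ((X.mesh.nbr f).val (X.potential U) - f.val (X.potential U)) ⬝ᵥ X.mesh.normal f :=
      X.merriamRoeFlux_le _ (hU _ _) (hU _ _)
    have hB : ∀ c : FacePt K p → BrennerCoeff, 0 ≤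
        ((X.mesh.nbr f).val (X.w U) - f.val (X.w U)) ⬝ᵥ X.brennerFace c U f := fun c =>
      brennerTwoPoint_nonneg _ _ _ (hU _ _) (hU _ _)
    have hB1 := hB c.ipVisc
    have hB2 := hB c.adFace
    have hB3 := hB c.ipAD
    beta_reduce
    rw [← neg_sub ((X.mesh.nbr f).val (X.w U)) (f.val (X.w U)),
      ← neg_sub ((X.mesh.nbr f).val (X.potential U)) (f.val (X.potential U))]
    simp only [faceFlux, neg_dotProduct, dotProduct_add, dotProduct_neg, dotProduct_smul,
      smul_eq_mul]
    linarith
  linarith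

lemma sum_sub_dotProduct_rhs (c : Coeffs X) (hU : ∀ k a, X.gas.Admissible (U k a)) (v : State) :
    X.sum (fun k a => (X.w U k a - v) ⬝ᵥ X.rhs c U k a) = -X.dissipation c U := by
  have h := X.sum_const_dotProduct_rhs c hU v
  simp only [Scheme.sum] at h
  simp only [dissipation, Scheme.sum, sub_dotProduct, smul_sub, Finset.sum_sub_distrib, h]
  ring

end Scheme

/-! ### Decay of the relative entropy in time -/

/-- A nonincreasing function loses the integral of its dissipation rate; the rate is integrable
because it is a derivative of constant sign. -/
lemma integral_dissipation_eq {f d : ℝ → ℝ} {a b : ℝ} (hab : a ≤ b)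
    (hf : ContinuousOn f (Set.Icc a b)) (hd : ∀ s ∈ Set.Ioo a b, HasDerivAt f (-d s) s)
    (hpos : ∀ s ∈ Set.Ioo a b, 0 ≤ d s) :
    IntervalIntegrable d MeasureTheory.volume a b ∧ ∫ s in a..b, d s = f a - f b := by
  have hd' : ∀ s ∈ Set.Ioo a b, HasDerivAt (fun s => -f s) (d s) s := fun s hs => by
    simpa using (hd s hs).fun_neg
  have hint : IntervalIntegrable d MeasureTheory.volume a b := by
    refine intervalIntegral.intervalIntegrable_deriv_of_nonneg (g := fun s => -f s) ?_ ?_ ?_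
    · rw [Set.uIcc_of_le hab]; exact hf.neg
    · rwa [min_eq_left hab, max_eq_right hab]
    · rwa [min_eq_left hab, max_eq_right hab]
  refine ⟨hint, ?_⟩
  rw [intervalIntegral.integral_eq_sub_of_hasDerivAt_of_le hab hf.neg hd' hint, Pi.neg_apply,
    Pi.neg_apply]
  ring

section TimeLevels
variable {t : ℕ → ℝ} {n i : ℕ}

lemma Icc_levels_subset (ht : StrictMono t) (hi : i ∈ Finset.Ico 1 n) :
    Set.Icc (t i) (t (i + 1)) ⊆ Set.Icc (t 1) (t n) := by
  rw [Finset.mem_Ico] at hi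
  exact Set.Icc_subset_Icc (ht.monotone hi.1) (ht.monotone hi.2)

lemma Ioo_levels_subset (ht : StrictMono t) (hi : i ∈ Finset.Ico 1 n) :
    Set.Ioo (t i) (t (i + 1)) ⊆ Set.Ioo (t 1) (t n) := by
  rw [Finset.mem_Ico] at hi
  exact Set.Ioo_subset_Ioo (ht.monotone hi.1) (ht.monotone hi.2)

lemma ne_level (ht : StrictMono t) {s : ℝ} (hs : s ∈ Set.Ioo (t i) (t (i + 1))) (j : ℕ) :
    s ≠ t j := by
  rintro rfl
  have h1 := ht.lt_iff_lt.1 hs.1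
  have h2 := ht.lt_iff_lt.1 hs.2
  omega

/-- The derivative is unavailable at the time levels, so monotonicity is glued from the steps. -/
lemma antitoneOn_of_levels (ht : StrictMono t) {f : ℝ → ℝ} (hn : 1 ≤ n)
    (h : ∀ i ∈ Finset.Ico 1 n, AntitoneOn f (Set.Icc (t i) (t (i + 1)))) :
    AntitoneOn f (Set.Icc (t 1) (t n)) := by
  induction n, hn using Nat.le_induction with
  | base => simp [Set.Icc_self]
  | succ m hm ih =>
    have h1 := ht.monotone hm
    have h2 := ht.monotone (Nat.le_succ m)
    rw [← Set.Icc_union_Icc_eq_Icc h1 h2]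
    refine (ih fun i hi => h i ?_).union_right (h m (by simp [hm])) (isGreatest_Icc h1)
      (isLeast_Icc h2)
    simp only [Finset.mem_Ico] at hi ⊢
    omega

end TimeLevels

namespace Gas
variable {g : Gas} {u u₀ : State}

lemma relEntropy_eq (g : Gas) (u₀ u : State) :
    g.relEntropy u₀ u = g.entropy u - g.entropy u₀ - fderiv ℝ g.entropy u₀ (u - u₀) := by
  rw [fderiv_entropy_apply, relEntropy]

lemma Admissible.continuousAt_relEntropy (h : g.Admissible u) :
    ContinuousAt (g.relEntropy u₀) u := by
  have : g.relEntropy u₀ = fun u => g.entropy u - g.entropy u₀ -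
      fderiv ℝ g.entropy u₀ (u - u₀) := funext fun u => g.relEntropy_eq u₀ u
  rw [this]
  exact (h.differentiableAt_entropy.continuousAt.sub continuousAt_const).sub
    ((fderiv ℝ g.entropy u₀).continuous.continuousAt.comp
      (continuousAt_id.sub continuousAt_const))

lemma Admissible.hasDerivAt_relEntropy {v : ℝ → State} {v' : State} {s : ℝ}
    (h : g.Admissible (v s)) (hv : HasDerivAt v v' s) :
    HasDerivAt (fun s => g.relEntropy u₀ (v s)) ((g.entropyVar (v s) - g.entropyVar u₀) ⬝ᵥ v') s := by
  simp only [relEntropy_eq, sub_dotProduct, ← fderiv_entropy_apply]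
  exact ((h.differentiableAt_entropy.hasFDerivAt.comp_hasDerivAt s hv).sub_const _).sub
    ((fderiv ℝ g.entropy u₀).hasFDerivAt.comp_hasDerivAt s (hv.sub_const u₀))

end Gas

namespace Scheme
variable {K p : ℕ} {X : Scheme K p} {coef : ℝ → Coeffs X} {t : ℕ → ℝ} {n : ℕ}
  {U : ℝ → Grid K p}

lemma IsSolution.continuousOn_totalRelEntropy (hU : X.IsSolution coef t n U) (u₀ : State) :
    ContinuousOn (fun s => X.totalRelEntropy u₀ (U s)) (Set.Icc (t 1) (t n)) := by
  simp only [totalRelEntropy, integral, Scheme.sum, smul_eq_mul]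
  refine continuousOn_finsetSum _ fun k _ => continuousOn_finsetSum _ fun a _ =>
    continuousOn_const.mul (continuousOn_const.mul fun s hs => ?_)
  have h1 : ContinuousWithinAt (fun s => U s k a) (Set.Icc (t 1) (t n)) s :=
    (continuous_apply_apply k a).continuousAt.comp_continuousWithinAt (hU.continuousOn s hs)
  exact ((hU.admissible s hs k a).continuousAt_relEntropy (u₀ := u₀)).comp_continuousWithinAt
    (f := fun s => U s k a) h1

lemma IsSolution.hasDerivAt_totalRelEntropy (hU : X.IsSolution coef t n U) (u₀ : State) {s : ℝ}
    (hs : s ∈ Set.Ioo (t 1) (t n)) (hne : ∀ i, s ≠ t i) :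
    HasDerivAt (fun s => X.totalRelEntropy u₀ (U s)) (-X.dissipation (coef s) (U s)) s := by
  have hadm := hU.admissible s ⟨hs.1.le, hs.2.le⟩
  rw [← sum_sub_dotProduct_rhs (coef s) hadm (X.gas.entropyVar u₀)]
  simp only [totalRelEntropy, integral, Scheme.sum, smul_eq_mul]
  refine HasDerivAt.fun_sum fun k _ => HasDerivAt.fun_sum fun a _ => HasDerivAt.const_mul _ ?_
  have hJ := (X.mesh.J_pos k a).ne'
  have h1 : HasDerivAt (fun s => U s k a) ((X.mesh.J k a)⁻¹ • X.rhs (coef s) (U s) k a) s := by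
    simpa [smul_smul, inv_mul_cancel₀ hJ] using
      (hU.equation s hs hne k a).fun_const_smul (X.mesh.J k a)⁻¹
  refine (((hadm k a).hasDerivAt_relEntropy (u₀ := u₀) h1).const_mul (X.mesh.J k a)).congr_deriv ?_
  rw [dotProduct_smul, smul_eq_mul, mul_inv_cancel_left₀ hJ]
  rfl

/-- On each time step, the relative entropy decreases by the integrated dissipation. -/
lemma IsSolution.step (hU : X.IsSolution coef t n U) (ht : StrictMono t) (u₀ : State) {i : ℕ}
    (hi : i ∈ Finset.Ico 1 n) :
    IntervalIntegrable (fun s => X.dissipation (coef s) (U s)) MeasureTheory.volume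
        (t i) (t (i + 1)) ∧
      0 ≤ X.meanDissipation coef U t i ∧
      X.totalRelEntropy u₀ (U (t (i + 1))) =
        X.totalRelEntropy u₀ (U (t i)) - (t (i + 1) - t i) * X.meanDissipation coef U t i := by
  have hlt : t i < t (i + 1) := ht (Nat.lt_succ_self i)
  have hpos : ∀ s ∈ Set.Icc (t i) (t (i + 1)), 0 ≤ X.dissipation (coef s) (U s) := fun s hs =>
    dissipation_nonneg _ (hU.admissible s (Icc_levels_subset ht hi hs))
  obtain ⟨h1, h2⟩ := integral_dissipation_eq hlt.le
    ((hU.continuousOn_totalRelEntropy u₀).mono (Icc_levels_subset ht hi))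
    (fun s hs => hU.hasDerivAt_totalRelEntropy u₀ (Ioo_levels_subset ht hi hs) (ne_level ht hs))
    (fun s hs => hpos s ⟨hs.1.le, hs.2.le⟩)
  refine ⟨h1, mul_nonneg (inv_nonneg.2 (sub_nonneg.2 hlt.le))
    (intervalIntegral.integral_nonneg hlt.le hpos), ?_⟩
  rw [meanDissipation, mul_inv_cancel_left₀ (sub_pos.2 hlt).ne', h2]
  ring

lemma IsSolution.antitoneOn (hU : X.IsSolution coef t n U) (ht : StrictMono t) (hn : 1 ≤ n)
    (u₀ : State) :
    AntitoneOn (fun s => X.totalRelEntropy u₀ (U s)) (Set.Icc (t 1) (t n)) := by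
  refine antitoneOn_of_levels ht hn fun i hi => antitoneOn_of_deriv_nonpos (convex_Icc _ _)
    ((hU.continuousOn_totalRelEntropy u₀).mono (Icc_levels_subset ht hi)) ?_ ?_ <;>
    rw [interior_Icc] <;> intro s hs
  · exact (hU.hasDerivAt_totalRelEntropy u₀ (Ioo_levels_subset ht hi hs)
      (ne_level ht hs)).differentiableAt.differentiableWithinAt
  · rw [(hU.hasDerivAt_totalRelEntropy u₀ (Ioo_levels_subset ht hi hs) (ne_level ht hs)).deriv]
    exact neg_nonpos.2 (dissipation_nonneg _
      (hU.admissible s (Icc_levels_subset ht hi ⟨hs.1.le, hs.2.le⟩)))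

lemma IsSolution.totalRelEntropy_eq_entropyBudget (hU : X.IsSolution coef t n U)
    (ht : StrictMono t) (hn : 1 ≤ n) (u₀ : State) :
    X.totalRelEntropy u₀ (U (t n)) = X.entropyBudget coef U t u₀ n := by
  have h : ∀ m, 1 ≤ m → m ≤ n →
      X.totalRelEntropy u₀ (U (t m)) = X.entropyBudget coef U t u₀ m := by
    intro m hm
    induction m, hm using Nat.le_induction with
    | base => intro _; simp [entropyBudget]
    | succ m hm ih =>
      intro hmn
      rw [(hU.step ht u₀ (Finset.mem_Ico.2 ⟨hm, hmn⟩)).2.2, ih (by omega), entropyBudget,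
        entropyBudget, Finset.sum_Ico_succ_top hm]
      ring
  exact h n hn le_rfl

lemma IsSolution.entropyBudget_le (hU : X.IsSolution coef t n U) (ht : StrictMono t)
    (u₀ : State) : X.entropyBudget coef U t u₀ n ≤ X.totalRelEntropy u₀ (U (t 1)) :=
  sub_le_self _ (Finset.sum_nonneg fun i hi =>
    mul_nonneg (sub_nonneg.2 (ht (Nat.lt_succ_self i)).le) (hU.step ht u₀ hi).2.1)

/-! ### Bounds of the solution by the relative entropy -/

section Integral
variable {φ ψ : Fin K → Node p → ℝ}

lemma integral_mono (h : ∀ k a, φ k a ≤ ψ k a) : X.integral φ ≤ X.integral ψ := by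
  simp only [integral, Scheme.sum, smul_eq_mul]
  exact Finset.sum_le_sum fun k _ => Finset.sum_le_sum fun a _ =>
    mul_le_mul_of_nonneg_left (mul_le_mul_of_nonneg_left (h k a) (X.mesh.J_pos k a).le)
      (X.sbp.weight_pos a).le

lemma integral_add (φ ψ : Fin K → Node p → ℝ) :
    X.integral (fun k a => φ k a + ψ k a) = X.integral φ + X.integral ψ := by
  simp only [integral, Scheme.sum, smul_eq_mul, mul_add, Finset.sum_add_distrib]

lemma integral_const_mul (c : ℝ) (φ : Fin K → Node p → ℝ) :
    X.integral (fun k a => c * φ k a) = c * X.integral φ := by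
  simp only [integral, Scheme.sum, smul_eq_mul, Finset.mul_sum]
  exact Finset.sum_congr rfl fun _ _ => Finset.sum_congr rfl fun _ _ => by ring

end Integral

/-- The quadratic form in the Taylor remainder of the entropy. -/
def remainder (X : Scheme K p) (u₀ : State) (U Ũ : Grid K p) (k : Fin K) (a : Node p) : ℝ :=
  (U k a - u₀) ⬝ᵥ (X.gas.entropyHessian (Ũ k a) *ᵥ (U k a - u₀))

lemma IsTaylor.integral_remainder {u₀ : State} {U Ũ : Grid K p} (h : X.IsTaylor u₀ U Ũ) :
    X.integral (X.remainder u₀ U Ũ) = 2 * X.totalRelEntropy u₀ U := by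
  rw [totalRelEntropy, ← integral_const_mul]
  congr 1; funext k a
  rw [Gas.relEntropy, (h k a).2.2, remainder]
  ring

/-- A quantity that is controlled pointwise by the remainder up to a factor `b` is controlled in
the mean up to the maximum of `b`. -/
lemma IsTaylor.integral_le_iSup_mul {u₀ : State} {U Ũ : Grid K p} (h : X.IsTaylor u₀ U Ũ)
    {b : State → ℝ} {φ : Fin K → Node p → ℝ} (hb : ∀ k a, 0 < b (Ũ k a))
    (hφ : ∀ k a, φ k a / b (Ũ k a) ≤ X.remainder u₀ U Ũ k a) :
    X.integral φ ≤ 2 * (⨆ k, ⨆ a, b (Ũ k a)) * X.totalRelEntropy u₀ U := by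
  have h1 : X.integral φ ≤ X.integral fun k a => (⨆ k, ⨆ a, b (Ũ k a)) * X.remainder u₀ U Ũ k a :=
    integral_mono fun k a => by
      have h2 : b (Ũ k a) ≤ ⨆ k, ⨆ a, b (Ũ k a) :=
        (le_ciSup (f := fun a => b (Ũ k a)) (Set.finite_range _).bddAbove a).trans
          (le_ciSup (f := fun k => ⨆ a, b (Ũ k a)) (Set.finite_range _).bddAbove k)
      rw [mul_comm]
      exact ((div_le_iff₀ (hb k a)).1 (hφ k a)).trans
        (mul_le_mul_of_nonneg_left h2 ((h k a).2.1.quadForm_nonneg _))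
  rw [integral_const_mul, h.integral_remainder] at h1
  linarith

/-- The case of a squared deviation `(x - x₀)²`. -/
lemma IsTaylor.integral_sq_le_iSup_mul {u₀ : State} {U Ũ : Grid K p} (h : X.IsTaylor u₀ U Ũ)
    {b : State → ℝ} {x : Fin K → Node p → ℝ} {x₀ : ℝ} (hb : ∀ k a, 0 < b (Ũ k a))
    (hx : ∀ k a, (x k a - x₀) ^ 2 / b (Ũ k a) ≤ X.remainder u₀ U Ũ k a) :
    X.integral (fun k a => x k a ^ 2) ≤ 4 * (⨆ k, ⨆ a, b (Ũ k a)) * X.totalRelEntropy u₀ U +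
      2 * X.integral (fun _ _ => x₀ ^ 2) := by
  have h1 := h.integral_le_iSup_mul hb hx
  have h2 : X.integral (fun k a => x k a ^ 2) ≤
      X.integral fun k a => 2 * (x k a - x₀) ^ 2 + 2 * x₀ ^ 2 :=
    integral_mono fun k a => by linarith [sq_nonneg (x k a - 2 * x₀)]
  rw [integral_add, integral_const_mul, integral_const_mul] at h2
  linarith

/-- The bounds of the full state by the smallest eigenvalue of the entropy Hessians. -/
lemma IsTaylor.integral_dotProduct_le {u₀ : State} {U Ũ : Grid K p} (h : X.IsTaylor u₀ U Ũ)
    {lam : ℝ} (hlam : 0 < lam) (hle : ∀ k a x,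
      lam * (x ⬝ᵥ x) ≤ x ⬝ᵥ (X.gas.entropyHessian (Ũ k a) *ᵥ x)) :
    2 * lam * X.integral (fun k a => (U k a - u₀) ⬝ᵥ (U k a - u₀)) ≤
        4 * X.totalRelEntropy u₀ U ∧
      X.integral (fun k a => U k a ⬝ᵥ U k a) ≤
        4 * (X.totalRelEntropy u₀ U / lam) + 2 * X.integral (fun _ _ => u₀ ⬝ᵥ u₀) := by
  have h1 : lam * X.integral (fun k a => (U k a - u₀) ⬝ᵥ (U k a - u₀)) ≤
      2 * X.totalRelEntropy u₀ U := by
    rw [← h.integral_remainder, ← integral_const_mul]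
    exact integral_mono fun k a => hle k a _
  refine ⟨by linarith, ?_⟩
  have h2 : X.integral (fun k a => U k a ⬝ᵥ U k a) ≤ X.integral fun k a =>
      2 * ((U k a - u₀) ⬝ᵥ (U k a - u₀)) + 2 * (u₀ ⬝ᵥ u₀) :=
    integral_mono fun k a => by
      simp only [dotProduct, Finset.mul_sum, ← Finset.sum_add_distrib, Pi.sub_apply]
      exact Finset.sum_le_sum fun i _ => by nlinarith [sq_nonneg (U k a i - 2 * u₀ i)]
  rw [integral_add, integral_const_mul, integral_const_mul] at h2
  have h3 : X.integral (fun k a => (U k a - u₀) ⬝ᵥ (U k a - u₀)) ≤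
      2 * (X.totalRelEntropy u₀ U / lam) := by
    rw [← mul_div_assoc, le_div_iff₀ hlam]; linarith
  linarith

end Scheme

lemma momentum_eq_zero {u : State} (hu : density u ≠ 0) {i : Fin 3} (hV : velocity u i = 0) :
    momentum u i = 0 :=
  (div_eq_zero_iff.1 hV).resolve_right hu

end

end FluxLim

theorem mainTheorem3 {K p : ℕ} [NeZero K] (X : FluxLim.Scheme K p)
    (coef : ℝ → FluxLim.Coeffs X) (t : ℕ → ℝ) (ht : StrictMono t) (n : ℕ) (hn : 1 ≤ n)
    (U : ℝ → FluxLim.Grid K p) (hU : X.IsSolution coef t n U)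
    (u₀ : FluxLim.State) (hu₀ : X.gas.Admissible u₀) (hV₀ : ∀ i, FluxLim.velocity u₀ i = 0) :
    -- dissipation, conservation, and the contracted scheme
    (∀ s ∈ Set.Icc (t 1) (t n),
      0 ≤ X.dissipation (coef s) (U s) ∧
      X.sum (X.rhs (coef s) (U s)) = 0 ∧
      X.sum (fun k a => (X.w (U s) k a - X.gas.entropyVar u₀) ⬝ᵥ X.rhs (coef s) (U s) k a) =
        -X.dissipation (coef s) (U s)) ∧
    -- the discrete relative entropy decays
    AntitoneOn (fun s => X.totalRelEntropy u₀ (U s)) (Set.Icc (t 1) (t n)) ∧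
    (∀ i ∈ Finset.Ico 1 n,
      IntervalIntegrable (fun s => X.dissipation (coef s) (U s)) MeasureTheory.volume
        (t i) (t (i + 1)) ∧
      0 ≤ X.meanDissipation coef U t i ∧
      X.totalRelEntropy u₀ (U (t (i + 1))) ≤
        X.totalRelEntropy u₀ (U (t i)) - (t (i + 1) - t i) * X.meanDissipation coef U t i) ∧
    X.totalRelEntropy u₀ (U (t n)) ≤ X.entropyBudget coef U t u₀ n ∧
    X.entropyBudget coef U t u₀ n ≤ X.totalRelEntropy u₀ (U (t 1)) ∧
    -- Taylor expansion with admissible intermediate states, and the bounds it yields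
    (∃ Ũ : FluxLim.Grid K p, X.IsTaylor u₀ (U (t n)) Ũ) ∧
    (∀ Ũ : FluxLim.Grid K p, X.IsTaylor u₀ (U (t n)) Ũ →
      (∃ lam : ℝ,
        IsLeast {e : ℝ | ∃ k a, Module.End.HasEigenvalue
          (Matrix.toLin' (X.gas.entropyHessian (Ũ k a))) e} lam ∧
        0 < lam ∧
        2 * lam * X.integral (fun k a => (U (t n) k a - u₀) ⬝ᵥ (U (t n) k a - u₀)) ≤
          4 * X.entropyBudget coef U t u₀ n ∧
        X.integral (fun k a => U (t n) k a ⬝ᵥ U (t n) k a) ≤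
          4 * (X.entropyBudget coef U t u₀ n / lam) + 2 * X.integral (fun _ _ => u₀ ⬝ᵥ u₀)) ∧
      (∀ k a,
        0 < X.gas.bDensity (Ũ k a) ∧ (∀ i, 0 < X.gas.bMomentum i (Ũ k a)) ∧
        0 < X.gas.bEnergy (Ũ k a) ∧
        (FluxLim.density (U (t n) k a) - FluxLim.density u₀) ^ 2 / X.gas.bDensity (Ũ k a) ≤
          (U (t n) k a - u₀) ⬝ᵥ (X.gas.entropyHessian (Ũ k a) *ᵥ (U (t n) k a - u₀)) ∧
        (∀ i, FluxLim.momentum (U (t n) k a) i ^ 2 / X.gas.bMomentum i (Ũ k a) ≤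
          (U (t n) k a - u₀) ⬝ᵥ (X.gas.entropyHessian (Ũ k a) *ᵥ (U (t n) k a - u₀))) ∧
        (FluxLim.totalEnergy (U (t n) k a) - FluxLim.totalEnergy u₀) ^ 2 /
            X.gas.bEnergy (Ũ k a) ≤
          (U (t n) k a - u₀) ⬝ᵥ (X.gas.entropyHessian (Ũ k a) *ᵥ (U (t n) k a - u₀))) ∧
      X.integral (fun k a => FluxLim.density (U (t n) k a) ^ 2) ≤
        4 * (⨆ k, ⨆ a, X.gas.bDensity (Ũ k a)) * X.entropyBudget coef U t u₀ n +
          2 * X.integral (fun _ _ => FluxLim.density u₀ ^ 2) ∧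
      (∀ i, X.integral (fun k a => FluxLim.momentum (U (t n) k a) i ^ 2) ≤
        2 * (⨆ k, ⨆ a, X.gas.bMomentum i (Ũ k a)) * X.entropyBudget coef U t u₀ n) ∧
      X.integral (fun k a => FluxLim.totalEnergy (U (t n) k a) ^ 2) ≤
        4 * (⨆ k, ⨆ a, X.gas.bEnergy (Ũ k a)) * X.entropyBudget coef U t u₀ n +
          2 * X.integral (fun _ _ => FluxLim.totalEnergy u₀ ^ 2)) := by
  have hpt : ∀ Ũ : FluxLim.Grid K p, X.IsTaylor u₀ (U (t n)) Ũ → ∀ k a,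
      (0 < X.gas.bDensity (Ũ k a) ∧ (∀ i, 0 < X.gas.bMomentum i (Ũ k a)) ∧
        0 < X.gas.bEnergy (Ũ k a)) ∧
      (FluxLim.density (U (t n) k a) - FluxLim.density u₀) ^ 2 / X.gas.bDensity (Ũ k a) ≤
        X.remainder u₀ (U (t n)) Ũ k a ∧
      (∀ i, FluxLim.momentum (U (t n) k a) i ^ 2 / X.gas.bMomentum i (Ũ k a) ≤
        X.remainder u₀ (U (t n)) Ũ k a) ∧
      (FluxLim.totalEnergy (U (t n) k a) - FluxLim.totalEnergy u₀) ^ 2 /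
        X.gas.bEnergy (Ũ k a) ≤ X.remainder u₀ (U (t n)) Ũ k a := by
    intro Ũ hT k a
    have h := (hT k a).2.1
    refine ⟨⟨h.bDensity_pos, h.bMomentum_pos, h.bEnergy_pos⟩, h.density_sq_div_le (U (t n) k a - u₀),
      fun i => ?_, h.totalEnergy_sq_div_le (U (t n) k a - u₀)⟩
    have e : FluxLim.momentum (U (t n) k a) i = FluxLim.momentum (U (t n) k a - u₀) i := by
      have h0 := FluxLim.momentum_eq_zero hu₀.density_pos.ne' (hV₀ i)
      simp only [FluxLim.momentum, Pi.sub_apply] at h0 ⊢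
      rw [h0, sub_zero]
    rw [e]
    exact h.momentum_sq_div_le _ i
  have hB := hU.totalRelEntropy_eq_entropyBudget ht hn u₀
  have hn1 : t n ∈ Set.Icc (t 1) (t n) := Set.right_mem_Icc.2 (ht.monotone hn)
  refine ⟨fun s hs => ?_, hU.antitoneOn ht hn u₀, fun i hi => ?_, hB.le,
    hU.entropyBudget_le ht u₀, ?_, fun Ũ hT => ?_⟩
  · have hadm := hU.admissible s hs
    exact ⟨FluxLim.Scheme.dissipation_nonneg _ hadm, X.sum_rhs _ hadm,
      FluxLim.Scheme.sum_sub_dotProduct_rhs _ hadm _⟩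
  · obtain ⟨h1, h2, h3⟩ := hU.step ht u₀ hi
    exact ⟨h1, h2, h3.le⟩
  · choose Ũ h1 h2 h3 using fun k a =>
      FluxLim.Gas.exists_taylor hu₀ (hU.admissible _ hn1 k a)
    exact ⟨Ũ, fun k a => ⟨h1 k a, h2 k a, h3 k a⟩⟩
  · have hb := hpt Ũ hT
    rw [← hB]
    refine ⟨?_, fun k a => ?_,
      hT.integral_sq_le_iSup_mul (fun k a => (hb k a).1.1) fun k a => (hb k a).2.1,
      fun i => hT.integral_le_iSup_mul (b := X.gas.bMomentum i)
        (fun k a => (hb k a).1.2.1 i) fun k a => (hb k a).2.2.1 i,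
      hT.integral_sq_le_iSup_mul (fun k a => (hb k a).1.2.2) fun k a => (hb k a).2.2.2⟩
    · obtain ⟨lam, h1, h2, h3⟩ := FluxLim.Gas.exists_isLeast_eigenvalue fun k a => (hT k a).2.1
      exact ⟨lam, h1, h2, hT.integral_dotProduct_le h2 h3⟩
    · obtain ⟨⟨h1, h2, h3⟩, h4, h5, h6⟩ := hb k a
      exact ⟨h1, h2, h3, h4, h5, h6⟩
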